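/- Let $D\subset\mathbb C^n$ be a bounded domain and let $r$ be a real-valued $C^4$ defining function for $D$: $r$ is of class $C^4$ on an open neighbourhood $U$ of $\overline D$, $D=\{z\in U: r(z)<0\}$ and $dr\neq0$ on $\partial D$. Assume that the complex Hessian $H(r)=[r_{i\overline j}]$, $r_{i\overline j}=\partial^2r/\partial z_i\partial\overline z_j$, is positive definite at every point of $\partial D$. Subscripts $k$, $\overline\ell$ on $r$ denote $\partial/\partial z_k$, $\partial/\partial\overline z_\ell$, repeated indices are summed from $1$ to $n$, and $$[r^{i\overline j}]^t=H(r)^{-1},\quad r^i=r^{i\overline j}r_{\overline j},\quad r^{\overline j}=r^{i\overline j}r_i,\quad |\partial r|_r^2=r^{i\overline j}r_ir_{\overline j},\quad a^{i\overline j}=a^{i\overline j}[r]=r^{i\overline j}-\frac{r^ir^{\overline j}}{-r+|\partial r|_r^2},$$ $$\tilde\Delta f=a^{i\overline j}\frac{\partial^2f}{\partial z_i\partial\overline z_j},\qquad |\tilde\nabla f|^2=a^{i\overline j}\frac{\partial f}{\partial z_i}\frac{\partial f}{\partial\overline z_j},\qquad J(r)=-\det\begin{bmatrix} r&\overline\partial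 r\\ (\overline\partial r)^*&H(r)\end{bmatrix},$$ where $\overline\partial r=(r_{\overline1},\dots,r_{\overline n})$ and $(\overline\partial r)^*=(r_1,\dots,r_n)^t$. Put $$\tilde E(r)=\frac{|\partial r|_r^2}{n(n+1)}\Big[\tilde\Delta\log J(r)-\frac{n}{n+1}|\tilde\nabla\log J(r)|^2-2n\,\mathrm{Re}\,\frac{r^k\tilde\Delta r_k}{|\partial r|_r^2}\Big].$$ Then at every point of $\partial D$ $$\tilde E(r)\ \ge\ \frac{|\partial r|_r^2\,a^{k\overline\ell}}{n(n+1)}\Big[\tilde\Delta r_{k\overline\ell}-a^{i\overline q}r^{p\overline j}r_{i\overline jk}r_{p\overline q\overline\ell}-(\tilde\Delta r_k)(\tilde\Delta r_{\overline\ell})-n\,\frac{r^ir_{ik}\,r^{\overline j}r_{\overline j\overline\ell}}{|\partial r|_r^4}\Big]-\frac{2\,\mathrm{Re}\,r^k\tilde\Delta r_k}{n+1}$$ and $$\tilde E(r)\ \le\ \frac{|\partial r|_r^2\,a^{k\overline\ell}}{n(n+1)}\Big[\tilde\Delta r_{k\overline\ell}+\frac{a^{i\overline q}r^pr^{\overline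 j}r_{i\overline jk}r_{p\overline q\overline\ell}}{|\partial r|_r^2}+2\,\frac{a^{i\overline q}r_{ik}r_{\overline q\overline\ell}}{|\partial r|_r^2}\Big]-\frac{2\,\mathrm{Re}\,r^k\tilde\Delta r_k}{n+1}.$$ -/

import Mathlib

/-!
Complex calculus on `ℂⁿ = (Fin n → ℂ)` in index notation, for a real function `r`.
-/

noncomputable section

namespace Fefferman

variable {n : ℕ}

/-- The Wirtinger derivative `∂f/∂z_j = (∂f/∂x_j - i ∂f/∂y_j) / 2`. -/
def dz (j : Fin n) (f : (Fin n → ℂ) → ℂ) (z : Fin n → ℂ) : ℂ :=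
  (fderiv ℝ f z (Pi.single j 1) - Complex.I * fderiv ℝ f z (Pi.single j Complex.I)) / 2

/-- The Wirtinger derivative `∂f/∂z̄_j = (∂f/∂x_j + i ∂f/∂y_j) / 2`. -/
def dzbar (j : Fin n) (f : (Fin n → ℂ) → ℂ) (z : Fin n → ℂ) : ℂ :=
  (fderiv ℝ f z (Pi.single j 1) + Complex.I * fderiv ℝ f z (Pi.single j Complex.I)) / 2

/-- A real function regarded as a complex-valued one. -/
def toC (r : (Fin n → ℂ) → ℝ) (z : Fin n → ℂ) : ℂ := (r z : ℂ)

/-- The complex Hessian `H(r)`, with entries `r_{i j̄} = ∂²r/∂z_i∂z̄_j`. -/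
def hess (r : (Fin n → ℂ) → ℝ) (z : Fin n → ℂ) : Matrix (Fin n) (Fin n) ℂ :=
  Matrix.of fun i j => dz i (dzbar j (toC r)) z

open scoped ComplexOrder in
/-- `r` is strictly plurisubharmonic at every point of `S`: its complex Hessian is positive definite there. -/
def StrictlyPSHOn (r : (Fin n → ℂ) → ℝ) (S : Set (Fin n → ℂ)) : Prop :=
  ∀ z ∈ S, (hess r z).PosDef

/-- `r` is a negative defining function, of class `C^m` up to and across the boundary,
for the set `D`. -/
def IsDefiningFunction (m : ℕ) (D : Set (Fin n → ℂ)) (r : (Fin n → ℂ) → ℝ) : Prop :=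
  ∃ U : Set (Fin n → ℂ), IsOpen U ∧ closure D ⊆ U ∧ ContDiffOn ℝ m r U ∧
    D = {z ∈ U | r z < 0} ∧ ∀ z ∈ frontier D, fderiv ℝ r z ≠ 0

/-- The Fefferman operator
`J(r) = - det [[r, ∂̄r], [(∂̄r)^*, H(r)]]`; the matrix is Hermitian for `r` of class `C²`, so
that its determinant is real. -/
def feffermanJ (r : (Fin n → ℂ) → ℝ) (z : Fin n → ℂ) : ℝ :=
  (-(Matrix.fromBlocks
      (Matrix.of fun (_ _ : Unit) => toC r z)
      (Matrix.of fun (_ : Unit) (j : Fin n) => dzbar j (toC r) z)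
      (Matrix.of fun (i : Fin n) (_ : Unit) => dz i (toC r) z)
      (hess r z)).det).re

/-- `log J(r)`. -/
def logJ (r : (Fin n → ℂ) → ℝ) (z : Fin n → ℂ) : ℝ := Real.log (feffermanJ r z)

/-- `r^{i j̄}`, where `[r^{i j̄}]ᵗ = H(r)⁻¹`. -/
def rInv (r : (Fin n → ℂ) → ℝ) (z : Fin n → ℂ) (i j : Fin n) : ℂ := (hess r z)⁻¹ j i

/-- `r^i = ∑_j r^{i j̄} r_{j̄}`. -/
def rUp (r : (Fin n → ℂ) → ℝ) (z : Fin n → ℂ) (i : Fin n) : ℂ :=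
  ∑ j, rInv r z i j * dzbar j (toC r) z

/-- `r^{j̄} = ∑_i r^{i j̄} r_i`. -/
def rUpBar (r : (Fin n → ℂ) → ℝ) (z : Fin n → ℂ) (j : Fin n) : ℂ :=
  ∑ i, rInv r z i j * dz i (toC r) z

/-- `|∂r|²_r = ∑_{i,j} r^{i j̄} r_i r_{j̄}` (the sum is real since `[r^{i j̄}]` is Hermitian). -/
def gradSq (r : (Fin n → ℂ) → ℝ) (z : Fin n → ℂ) : ℝ :=
  (∑ i, ∑ j, rInv r z i j * dz i (toC r) z * dzbar j (toC r) z).re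

/-- `a^{i j̄}[r] = r^{i j̄} - r^i r^{j̄} / (-r + |∂r|²_r)`. -/
def aUp (r : (Fin n → ℂ) → ℝ) (z : Fin n → ℂ) (i j : Fin n) : ℂ :=
  rInv r z i j - rUp r z i * rUpBar r z j / ((-r z + gradSq r z : ℝ) : ℂ)

/-- `Δ̃ f = ∑_{i,j} a^{i j̄}[r] ∂²f/∂z_i∂z̄_j`. -/
def lapTilde (r : (Fin n → ℂ) → ℝ) (f : (Fin n → ℂ) → ℂ) (z : Fin n → ℂ) : ℂ :=
  ∑ i, ∑ j, aUp r z i j * dz i (dzbar j f) z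

/-- `|∇̃ f|² = ∑_{i,j} a^{i j̄}[r] (∂f/∂z_i) (∂f/∂z̄_j)`. -/
def gradTildeSq (r : (Fin n → ℂ) → ℝ) (f : (Fin n → ℂ) → ℂ) (z : Fin n → ℂ) : ℂ :=
  ∑ i, ∑ j, aUp r z i j * dz i f z * dzbar j f z

/-- `Ẽ(r) = |∂r|²_r / (n(n+1)) *
  [Δ̃ log J(r) - n |∇̃ log J(r)|² / (n+1) - 2n Re (∑_k r^k Δ̃ r_k / |∂r|²_r)]`. The first two terms
of the bracket are real because `log J(r)` is a real function. -/
def Etilde (r : (Fin n → ℂ) → ℝ) (z : Fin n → ℂ) : ℝ :=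
  gradSq r z / (n * (n + 1)) *
    ((lapTilde r (toC (logJ r)) z).re
      - n * (gradTildeSq r (toC (logJ r)) z).re / (n + 1)
      - 2 * n * ((∑ k, rUp r z k * lapTilde r (dz k (toC r)) z) / (gradSq r z : ℂ)).re)

/-- The third derivative `r_{i j̄ k}`. -/
def r3 (r : (Fin n → ℂ) → ℝ) (z : Fin n → ℂ) (i j k : Fin n) : ℂ :=
  dz k (dz i (dzbar j (toC r))) z

/-- The third derivative `r_{p q̄ l̄}`. -/
def r3bar (r : (Fin n → ℂ) → ℝ) (z : Fin n → ℂ) (p q l : Fin n) : ℂ :=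
  dzbar l (dz p (dzbar q (toC r))) z

/-- The second derivative `r_{i k}`. -/
def r2 (r : (Fin n → ℂ) → ℝ) (z : Fin n → ℂ) (i k : Fin n) : ℂ :=
  dz k (dz i (toC r)) z

/-- The second derivative `r_{q̄ l̄}`. -/
def r2bar (r : (Fin n → ℂ) → ℝ) (z : Fin n → ℂ) (q l : Fin n) : ℂ :=
  dzbar l (dzbar q (toC r)) z

end Fefferman

end

/-!
Near a boundary point `log J(r) = log (-det M)`, with `M` the bordered complex Hessian. As `r = 0`
on the boundary, `[a^{i j̄}]` annihilates `∂r`, so it is a sum of squares of tangential vectors `v`;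
both estimates then reduce to estimates of `∂_v ∂̄_v log J - n/(n+1) |∂_v log J|²` for a single
tangential `v`. The lower right block of `M⁻¹` is `a`, the transpose of `[a^{i j̄}]`, and with
`H = H(r)`, `X = ∂_v H`, `ξ = ∂_v(∂r)` and `K = H⁻¹ ∂r`, Jacobi's formula gives
`∂_v log J = tr (a X) + K* ξ / |∂r|²` and
`∂_v ∂̄_v log J = tr (a ∂_v ∂̄_v H) + (ξ - X K)* a (ξ - X K) / |∂r|² - tr (H⁻¹ X* a X)`.

For the lower bound, drop the middle term, which is nonnegative, and use
`n/(n+1) |p + q|² ≤ |p|² + n |q|²` for the two parts of `∂_v log J`. For the upper bound, drop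
`|∂_v log J|²` and expand the middle term by the parallelogram law: since `a ≥ 0`,
`tr (H⁻¹ X* a X) ≥ (X K)* a (X K) / |∂r|²`, which absorbs half of its third-order part.
-/

noncomputable section

namespace Fefferman

open Filter Topology Matrix Complex
open scoped Matrix.Norms.Operator

section Wirtinger

variable {E F G : Type*} [NormedAddCommGroup E] [NormedSpace ℂ E]
  [NormedAddCommGroup F] [NormedSpace ℂ F] [NormedAddCommGroup G] [NormedSpace ℂ G]

/-- `(∂_v f + ε ∂_{iv} f) / 2`: the Wirtinger derivative of `f` along `v` of type `(1,0)` for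
`ε = -i` and of type `(0,1)` for `ε = i`. -/
def wirtinger (ε : ℂ) (v : E) (f : E → F) (z : E) : F :=
  (2⁻¹ : ℂ) • (fderiv ℝ f z v + ε • fderiv ℝ f z (I • v))

variable {ε δ : ℂ} {v w : E} {f g : E → F} {z : E}

theorem wirtinger_congr (h : f =ᶠ[𝓝 z] g) : wirtinger ε v f z = wirtinger ε v g z := by
  rw [wirtinger, wirtinger, h.fderiv_eq]

theorem wirtinger_eventuallyEq (h : f =ᶠ[𝓝 z] g) :
    wirtinger ε v f =ᶠ[𝓝 z] wirtinger ε v g :=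
  h.eventuallyEq_nhds.mono fun _ => wirtinger_congr

theorem wirtinger_of_hasFDerivAt {f' : E →L[ℝ] F} (h : HasFDerivAt f f' z) :
    wirtinger ε v f z = (2⁻¹ : ℂ) • (f' v + ε • f' (I • v)) := by
  rw [wirtinger, h.fderiv]

theorem wirtinger_comp {φ : F → G} {φ' : F →L[ℂ] G} (hφ : HasFDerivAt φ φ' (f z))
    (hf : DifferentiableAt ℝ f z) :
    wirtinger ε v (fun y => φ (f y)) z = φ' (wirtinger ε v f z) := by
  have h : HasFDerivAt (fun y => φ (f y)) _ z :=
    (hφ.restrictScalars ℝ).comp z hf.hasFDerivAt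
  rw [wirtinger_of_hasFDerivAt h]
  simp [wirtinger]

theorem wirtinger_mul {A : Type*} [NormedRing A] [NormedAlgebra ℂ A] {f g : E → A}
    (hf : DifferentiableAt ℝ f z) (hg : DifferentiableAt ℝ g z) :
    wirtinger ε v (fun y => f y * g y) z = f z * wirtinger ε v g z + wirtinger ε v f z * g z := by
  have h : HasFDerivAt (fun y => f y * g y) _ z := hf.hasFDerivAt.mul' hg.hasFDerivAt
  rw [wirtinger_of_hasFDerivAt h]
  simp only [wirtinger, _root_.add_apply, _root_.smul_apply,
    op_smul_eq_mul, smul_eq_mul, smul_add, mul_add, add_mul, smul_mul_assoc, mul_smul_comm]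
  abel

theorem star_wirtinger [StarAddMonoid F] [NormedStarGroup F] [StarModule ℂ F] :
    star (wirtinger ε v f z) = wirtinger (star ε) v (fun y => star (f y)) z := by
  rw [wirtinger, wirtinger, fderiv_star]
  simp

theorem wirtinger_smul (hε : ε ^ 2 = -1) (c : ℂ) :
    wirtinger ε (c • v) f z = (c.re - c.im * ε) • wirtinger ε v f z := by
  have h (a : ℂ) : fderiv ℝ f z (a • v)
      = (a.re : ℂ) • fderiv ℝ f z v + (a.im : ℂ) • fderiv ℝ f z (I • v) := by
    conv_lhs => rw [← Complex.re_add_im a]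
    simp only [add_smul, mul_smul, Complex.coe_smul, map_add, map_smul]
  rw [wirtinger, wirtinger, smul_smul, h c, h (I * c), Complex.I_mul_re, Complex.I_mul_im,
    Complex.ofReal_neg]
  match_scalars
  · ring
  · linear_combination (c.im / 2 : ℂ) * hε

theorem wirtinger_sum {ι : Type*} (s : Finset ι) (e : ι → E) :
    wirtinger ε (∑ i ∈ s, e i) f z = ∑ i ∈ s, wirtinger ε (e i) f z := by
  simp only [wirtinger, Finset.smul_sum, map_sum, ← Finset.sum_add_distrib]

theorem wirtinger_neg_I_eq_sum {ι : Type*} [Fintype ι] [DecidableEq ι] {f : (ι → ℂ) → F}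
    (v z : ι → ℂ) :
    wirtinger (-I) v f z = ∑ k, v k • wirtinger (-I) (Pi.single k 1) f z := by
  conv_lhs => rw [pi_eq_sum_univ' v, wirtinger_sum]
  simp [wirtinger_smul, Complex.re_add_im]

theorem wirtinger_I_eq_sum {ι : Type*} [Fintype ι] [DecidableEq ι] {f : (ι → ℂ) → F}
    (v z : ι → ℂ) :
    wirtinger I v f z = ∑ k, star (v k) • wirtinger I (Pi.single k 1) f z := by
  have h (c : ℂ) : (c.re - c.im * I : ℂ) = star c := by
    apply Complex.ext <;> simp
  conv_lhs => rw [pi_eq_sum_univ' v, wirtinger_sum]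
  simp [wirtinger_smul, h]

theorem contDiffAt_wirtinger {m : ℕ} (hf : ContDiffAt ℝ (m + 1 : ℕ) f z) :
    ContDiffAt ℝ m (wirtinger ε v f) z := by
  have h : ContDiffAt ℝ m (fderiv ℝ f) z := hf.fderiv_right (by simp)
  exact ((h.clm_apply contDiffAt_const).add
    ((h.clm_apply contDiffAt_const).const_smul ε)).const_smul (2⁻¹ : ℂ)

theorem wirtinger_comm (hf : ContDiffAt ℝ (2 : ℕ) f z) :
    wirtinger ε v (wirtinger δ w f) z = wirtinger δ w (wirtinger ε v f) z := by
  have hd : DifferentiableAt ℝ (fderiv ℝ f) z :=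
    (hf.fderiv_right (m := (1 : ℕ)) (by norm_num)).differentiableAt (by simp)
  have hs : IsSymmSndFDerivAt ℝ f z := hf.isSymmSndFDerivAt (by simp)
  have h (x : E) : HasFDerivAt (fun y => fderiv ℝ f y x) ((fderiv ℝ (fderiv ℝ f) z).flip x) z := by
    simpa using hd.hasFDerivAt.clm_apply (hasFDerivAt_const x z)
  have h₂ (ε : ℂ) (x : E) : HasFDerivAt (wirtinger ε x f) _ z :=
    ((h x).fun_add ((h (I • x)).const_smul ε)).const_smul (2⁻¹ : ℂ)
  rw [wirtinger_of_hasFDerivAt (h₂ _ _), wirtinger_of_hasFDerivAt (h₂ _ _)]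
  simp only [_root_.add_apply, _root_.smul_apply, ContinuousLinearMap.flip_apply]
  rw [hs.eq v w, hs.eq v (I • w), hs.eq (I • v) w, hs.eq (I • v) (I • w)]
  module

theorem wirtinger_comm_eventuallyEq {m : ℕ} (hm : 2 ≤ m) (hf : ContDiffAt ℝ m f z) :
    wirtinger ε v (wirtinger δ w f) =ᶠ[𝓝 z] wirtinger δ w (wirtinger ε v f) :=
  (hf.eventually (by simp)).mono fun _ hy => wirtinger_comm (hy.of_le (by exact_mod_cast hm))

theorem contDiffAt_star {m : ℕ} {f : E → ℂ} (hf : ContDiffAt ℝ m f z) :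
    ContDiffAt ℝ m (fun y => star (f y)) z :=
  (starL' ℝ : ℂ ≃L[ℝ] ℂ).contDiff.contDiffAt.comp z hf

end Wirtinger

section MatrixCalculus

variable {ι : Type*} [Fintype ι] {E : Type*} [NormedAddCommGroup E] [NormedSpace ℂ E]
  {ε δ : ℂ} {v w z : E} {F : E → Matrix ι ι ℂ}

theorem wirtinger_matrix_apply {κ : Type*} [Fintype κ] {F : E → Matrix ι κ ℂ}
    (hF : DifferentiableAt ℝ F z) (i : ι) (j : κ) :
    wirtinger ε v F z i j = wirtinger ε v (fun y => F y i j) z :=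
  (wirtinger_comp (Matrix.entryLinearMap ℂ ℂ i j).toContinuousLinearMap.hasFDerivAt hF).symm

theorem contDiffAt_matrix {κ : Type*} [Fintype κ] {m : ℕ} {F : E → Matrix ι κ ℂ}
    (hF : ∀ i j, ContDiffAt ℝ m (fun y => F y i j) z) :
    ContDiffAt ℝ m F z := by
  have h : ContDiffAt ℝ m (fun y i j => F y i j) z :=
    contDiffAt_pi.2 fun i => contDiffAt_pi.2 fun j => hF i j
  exact ((Matrix.ofLinearEquiv (α := ℂ) (m := ι) (n := κ) ℝ).toContinuousLinearEquiv
    |>.contDiff.contDiffAt.comp z h)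

theorem wirtinger_trace (hF : DifferentiableAt ℝ F z) :
    wirtinger ε v (fun y => (F y).trace) z = (wirtinger ε v F z).trace :=
  wirtinger_comp (Matrix.traceLinearMap ι ℂ ℂ).toContinuousLinearMap.hasFDerivAt hF

variable [DecidableEq ι]

theorem sum_det_updateRow (M N : Matrix ι ι ℂ) :
    ∑ i, (M.updateRow i (N i)).det = (M.adjugate * N).trace := by
  rw [Matrix.trace_mul_comm, Matrix.trace]
  refine Finset.sum_congr rfl fun i _ => ?_
  rw [← Matrix.cramer_transpose_apply, Matrix.cramer_eq_adjugate_mulVec,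
    ← Matrix.adjugate_transpose, Matrix.mulVec_transpose]
  rfl

theorem hasFDerivAt_det (M : Matrix ι ι ℂ) :
    HasFDerivAt (Matrix.det : Matrix ι ι ℂ → ℂ)
      (LinearMap.toContinuousLinearMap
        (Matrix.traceLinearMap ι ℂ ℂ ∘ₗ LinearMap.mulLeft ℂ M.adjugate)) M := by
  let D : ContinuousMultilinearMap ℂ (fun _ : ι => ι → ℂ) ℂ :=
    ⟨Matrix.detRowAlternating.toMultilinearMap, Continuous.matrix_det continuous_id⟩
  refine HasFDerivAt.congr_fderiv (f := (Matrix.det : Matrix ι ι ℂ → ℂ)) (f' := D.linearDeriv M)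
    (D.hasFDerivAt M) ?_
  ext N
  exact (D.linearDeriv_apply M N).trans (sum_det_updateRow M N)

theorem contDiffAt_det {m : ℕ} (hF : ContDiffAt ℝ m F z) :
    ContDiffAt ℝ m (fun y => (F y).det) z := by
  simp only [Matrix.det_apply']
  exact ContDiffAt.sum fun σ _ => contDiffAt_const.mul (contDiffAt_prod fun i _ =>
    (Matrix.entryLinearMap ℝ ℂ (σ i) i).toContinuousLinearMap.contDiff.contDiffAt.comp z hF)

theorem hasFDerivAt_inv {M : Matrix ι ι ℂ} (hM : IsUnit M) :
    HasFDerivAt (fun X : Matrix ι ι ℂ => X⁻¹)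
      (-ContinuousLinearMap.mulLeftRight ℂ (Matrix ι ι ℂ) M⁻¹ M⁻¹) M := by
  obtain ⟨U, rfl⟩ := hM
  rw [← Matrix.coe_units_inv, funext Matrix.nonsing_inv_eq_ringInverse]
  exact hasFDerivAt_ringInverse U

theorem wirtinger_inv (hF : DifferentiableAt ℝ F z) (hz : IsUnit (F z)) :
    wirtinger ε v (fun y => (F y)⁻¹) z = -((F z)⁻¹ * wirtinger ε v F z * (F z)⁻¹) :=
  wirtinger_comp (hasFDerivAt_inv hz) hF

variable {c : ℂ}

theorem wirtinger_log_mul_det (hF : DifferentiableAt ℝ F z)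
    (hz : c * (F z).det ∈ slitPlane) :
    wirtinger ε v (fun y => Complex.log (c * (F y).det)) z
      = ((F z)⁻¹ * wirtinger ε v F z).trace := by
  have hlog : HasFDerivAt (fun X : Matrix ι ι ℂ => Complex.log (c * X.det)) _ (F z) :=
    ((hasFDerivAt_det (F z)).const_mul c).clog hz
  have hc : c ≠ 0 := left_ne_zero_of_mul (Complex.slitPlane_ne_zero hz)
  rw [wirtinger_comp hlog hF, Matrix.inv_def, Ring.inverse_eq_inv', Matrix.smul_mul,
    Matrix.trace_smul]
  change (c * (F z).det)⁻¹ * (c * ((F z).adjugate * wirtinger ε v F z).trace) = _ • _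
  rw [smul_eq_mul, mul_inv]
  field_simp

theorem wirtinger_wirtinger_log_mul_det (hF : ContDiffAt ℝ (2 : ℕ) F z)
    (hz : c * (F z).det ∈ slitPlane) :
    wirtinger ε v (wirtinger δ w fun y => Complex.log (c * (F y).det)) z
      = ((F z)⁻¹ * wirtinger ε v (wirtinger δ w F) z).trace
        - ((F z)⁻¹ * wirtinger ε v F z * (F z)⁻¹ * wirtinger δ w F z).trace := by
  have hunit : IsUnit (F z) := (Matrix.isUnit_iff_isUnit_det _).2
    (isUnit_iff_ne_zero.2 fun h => by simp [h] at hz)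
  have hd : DifferentiableAt ℝ F z := hF.differentiableAt (by simp)
  have hi : DifferentiableAt ℝ (fun y => (F y)⁻¹) z :=
    ((hasFDerivAt_inv hunit).restrictScalars ℝ |>.comp z hd.hasFDerivAt).differentiableAt
  have hw : DifferentiableAt ℝ (wirtinger δ w F) z :=
    (contDiffAt_wirtinger (m := 1) hF).differentiableAt (by simp)
  have hev : (wirtinger δ w fun y => Complex.log (c * (F y).det))
      =ᶠ[𝓝 z] fun y => ((F y)⁻¹ * wirtinger δ w F y).trace := by
    have hc : ContinuousAt (fun y => c * (F y).det) z :=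
      ((hasFDerivAt_det (F z)).continuousAt.comp hd.continuousAt).const_mul c
    filter_upwards [hF.eventually (by simp),
      hc.eventually (Complex.isOpen_slitPlane.mem_nhds hz)] with y hy hy'
    exact wirtinger_log_mul_det (hy.differentiableAt (by simp)) hy'
  rw [wirtinger_congr hev, wirtinger_trace (hi.fun_mul hw), wirtinger_mul hi hw,
    wirtinger_inv hd hunit, Matrix.trace_add, Matrix.neg_mul, Matrix.trace_neg, sub_eq_add_neg]

end MatrixCalculus

theorem trace_fromBlocks {l m R : Type*} [Fintype l] [Fintype m] [AddCommMonoid R]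
    (P : Matrix l l R) (Q : Matrix l m R) (S : Matrix m l R) (T : Matrix m m R) :
    (fromBlocks P Q S T).trace = P.trace + T.trace := by
  simp [Matrix.trace]

theorem trace_fromBlocks_variation {ι κ R : Type*} [Fintype ι] [Fintype κ] [CommRing R]
    {α : Matrix κ κ R} {b V : Matrix κ ι R} {c V' : Matrix ι κ R} {A H : Matrix ι ι R}
    (hV : V * H * A = V) (hV' : A * (H * V') = V') (hc : V * H * c = 0) (hb : b * (H * V') = 0)
    (ξ : Matrix ι κ R) (η : Matrix κ ι R) (X Y W : Matrix ι ι R) :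
    (fromBlocks α b c A * fromBlocks (V * H * V') (V * Y) (X * V') W).trace
      - (fromBlocks α b c A * fromBlocks 0 (V * H) ξ X * fromBlocks α b c A
          * fromBlocks 0 η (H * V') Y).trace
      = (A * W).trace - (α * (η * A * ξ)).trace - (b * (Y * A * ξ)).trace
        - (η * A * X * c).trace - (A * (Y * A * X)).trace := by
  have hprod : (c * (V * H) + A * X) * (c * η + A * Y)
      = c * (V * Y) + A * X * c * η + A * X * A * Y := by
    rw [Matrix.mul_add, Matrix.add_mul, Matrix.add_mul, Matrix.mul_assoc c, Matrix.mul_assoc c,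
      ← Matrix.mul_assoc (V * H), ← Matrix.mul_assoc (V * H), hc, hV, Matrix.zero_mul,
      Matrix.mul_zero]
    simp only [Matrix.mul_assoc, zero_add]
    abel
  rw [Matrix.mul_assoc (fromBlocks α b c A * fromBlocks 0 (V * H) ξ X)]
  simp only [fromBlocks_multiply, trace_fromBlocks, Matrix.mul_zero, zero_add, hb, hV', hprod]
  have h₁ : (A * (ξ * (α * η))).trace = (α * (η * (A * ξ))).trace := by
    rw [← Matrix.mul_assoc, Matrix.trace_mul_comm, Matrix.mul_assoc]
  have h₂ : (A * (ξ * (b * Y))).trace = (b * (Y * (A * ξ))).trace := by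
    rw [← Matrix.mul_assoc, Matrix.trace_mul_comm, Matrix.mul_assoc]
  have h₃ : (A * (X * (c * η))).trace = (η * (A * (X * c))).trace := by
    rw [Matrix.trace_mul_comm η, Matrix.mul_assoc, Matrix.mul_assoc]
  have h₄ : (A * (X * (A * Y))).trace = (A * (Y * (A * X))).trace := by
    rw [← Matrix.mul_assoc, Matrix.trace_mul_comm, Matrix.mul_assoc]
  simp only [Matrix.add_mul, Matrix.mul_add, Matrix.trace_add, Matrix.mul_assoc, h₁, h₂, h₃, h₄]
  ring

section TangentialInverse

variable {ι κ R : Type*} [Fintype ι] [DecidableEq ι] [Fintype κ] [DecidableEq κ] [CommRing R]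
  [StarRing R] {H : Matrix ι ι R} {U : Matrix ι κ R}

/-- The compression `a` of `H⁻¹` to the directions annihilated by the border `U`, that is, the
lower right block of the inverse of `fromBlocks 0 Uᴴ U H`. -/
def tangentialInv (H : Matrix ι ι R) (U : Matrix ι κ R) : Matrix ι ι R :=
  H⁻¹ - H⁻¹ * U * (Uᴴ * H⁻¹ * U)⁻¹ * (Uᴴ * H⁻¹)

theorem tangentialInv_mul_border (hG : IsUnit (Uᴴ * H⁻¹ * U)) : tangentialInv H U * U = 0 := by
  rw [tangentialInv, Matrix.sub_mul, Matrix.mul_assoc _ (Uᴴ * H⁻¹), Matrix.mul_assoc _ _ (_ * U),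
    Matrix.nonsing_inv_mul _ ((Matrix.isUnit_iff_isUnit_det _).1 hG), Matrix.mul_one, sub_self]

theorem isHermitian_tangentialInv (hH : H.IsHermitian) : (tangentialInv H U).IsHermitian := by
  have hi : H⁻¹ᴴ = H⁻¹ := hH.inv
  have hG : (Uᴴ * H⁻¹ * U)⁻¹ᴴ = (Uᴴ * H⁻¹ * U)⁻¹ := (isHermitian_conjTranspose_mul_mul U hi).inv
  simp only [IsHermitian, tangentialInv, conjTranspose_sub, conjTranspose_mul, hi, hG,
    conjTranspose_conjTranspose, ← Matrix.mul_assoc]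

theorem border_mul_tangentialInv (hH : H.IsHermitian) (hG : IsUnit (Uᴴ * H⁻¹ * U)) :
    Uᴴ * tangentialInv H U = 0 := by
  rw [← (isHermitian_tangentialInv hH).eq, ← conjTranspose_mul, tangentialInv_mul_border hG,
    conjTranspose_zero]

theorem mul_tangentialInv (hH : IsUnit H) :
    H * tangentialInv H U = 1 - U * (Uᴴ * H⁻¹ * U)⁻¹ * (Uᴴ * H⁻¹) := by
  have hdet : IsUnit H.det := (Matrix.isUnit_iff_isUnit_det _).1 hH
  rw [tangentialInv, Matrix.mul_sub, Matrix.mul_nonsing_inv _ hdet]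
  simp only [Matrix.mul_assoc, Matrix.mul_nonsing_inv_cancel_left _ _ hdet]

theorem mul_mul_tangentialInv (hH : IsUnit H) {μ : Type*} {V : Matrix μ ι R}
    (hV : V * U = 0) : V * H * tangentialInv H U = V := by
  rw [Matrix.mul_assoc, mul_tangentialInv hH, Matrix.mul_sub, Matrix.mul_one, Matrix.mul_assoc U,
    ← Matrix.mul_assoc V, hV, Matrix.zero_mul, sub_zero]

theorem inv_fromBlocks_zero_border (hH : H.IsHermitian) (hu : IsUnit H)
    (hG : IsUnit (Uᴴ * H⁻¹ * U)) :
    (fromBlocks 0 Uᴴ U H)⁻¹ = fromBlocks (-(Uᴴ * H⁻¹ * U)⁻¹) ((Uᴴ * H⁻¹ * U)⁻¹ * (Uᴴ * H⁻¹))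
      (H⁻¹ * U * (Uᴴ * H⁻¹ * U)⁻¹) (tangentialInv H U) := by
  have hdet : IsUnit H.det := (Matrix.isUnit_iff_isUnit_det _).1 hu
  have hGdet : IsUnit (Uᴴ * H⁻¹ * U).det := (Matrix.isUnit_iff_isUnit_det _).1 hG
  refine Matrix.inv_eq_right_inv ?_
  rw [fromBlocks_multiply, mul_tangentialInv hu, border_mul_tangentialInv hH hG,
    ← Matrix.mul_assoc, ← Matrix.mul_assoc, Matrix.mul_nonsing_inv _ hGdet, ← fromBlocks_one]
  congr 1
  · simp
  · simp
  · simp only [Matrix.mul_assoc, Matrix.mul_nonsing_inv_cancel_left _ _ hdet, Matrix.mul_neg,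
      neg_add_cancel]
  · rw [Matrix.mul_assoc U, add_sub_cancel]

theorem trace_inv_bordered_mul (hH : H.IsHermitian) (hu : IsUnit H)
    (hG : IsUnit (Uᴴ * H⁻¹ * U)) {V : Matrix κ ι R} (hV : V * U = 0) (ξ : Matrix ι κ R)
    (X : Matrix ι ι R) :
    ((fromBlocks 0 Uᴴ U H)⁻¹ * fromBlocks 0 (V * H) ξ X).trace
      = (tangentialInv H U * X).trace + ((Uᴴ * H⁻¹ * U)⁻¹ * (Uᴴ * H⁻¹ * ξ)).trace := by
  have h : (H⁻¹ * U * (Uᴴ * H⁻¹ * U)⁻¹ * (V * H)).trace = 0 := by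
    rw [Matrix.trace_mul_comm, ← Matrix.mul_assoc, ← Matrix.mul_assoc, Matrix.mul_assoc V,
      Matrix.mul_nonsing_inv _ ((Matrix.isUnit_iff_isUnit_det _).1 hu), Matrix.mul_one, hV,
      Matrix.zero_mul, Matrix.trace_zero]
  rw [inv_fromBlocks_zero_border hH hu hG, fromBlocks_multiply, trace_fromBlocks,
    Matrix.mul_zero, zero_add, Matrix.trace_add, h, zero_add, add_comm, Matrix.mul_assoc]

theorem trace_tangentialInv_mul (X : Matrix ι ι R) :
    (tangentialInv H U * X).trace
      = (H⁻¹ * X).trace - ((Uᴴ * H⁻¹ * U)⁻¹ * (Uᴴ * H⁻¹ * X * (H⁻¹ * U))).trace := by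
  rw [tangentialInv, Matrix.sub_mul, Matrix.trace_sub, Matrix.mul_assoc (H⁻¹ * U),
    Matrix.mul_assoc (H⁻¹ * U), Matrix.trace_mul_comm (H⁻¹ * U)]
  simp only [Matrix.mul_assoc]

theorem trace_second_variation (hH : H.IsHermitian) (hu : IsUnit H)
    (hG : IsUnit (Uᴴ * H⁻¹ * U)) {V : Matrix κ ι R} (hV : V * U = 0) (ξ : Matrix ι κ R)
    (X W : Matrix ι ι R) :
    ((fromBlocks 0 Uᴴ U H)⁻¹ * fromBlocks (V * H * Vᴴ) (V * Xᴴ) (X * Vᴴ) W).trace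
      - ((fromBlocks 0 Uᴴ U H)⁻¹ * fromBlocks 0 (V * H) ξ X * (fromBlocks 0 Uᴴ U H)⁻¹
          * (fromBlocks 0 (V * H) ξ X)ᴴ).trace
      = (tangentialInv H U * W).trace
        + ((Uᴴ * H⁻¹ * U)⁻¹
            * ((ξ - X * (H⁻¹ * U))ᴴ * tangentialInv H U * (ξ - X * (H⁻¹ * U)))).trace
        - (H⁻¹ * (Xᴴ * tangentialInv H U * X)).trace := by
  have hdet : IsUnit H.det := (Matrix.isUnit_iff_isUnit_det _).1 hu
  have hi : H⁻¹ᴴ = H⁻¹ := hH.inv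
  have hA : (tangentialInv H U)ᴴ = tangentialInv H U := isHermitian_tangentialInv hH
  have hVA := mul_mul_tangentialInv hu hV
  have hAV : tangentialInv H U * (H * Vᴴ) = Vᴴ := by
    simpa only [conjTranspose_mul, hA, hH.eq] using congrArg conjTranspose hVA
  have hUV : Uᴴ * Vᴴ = 0 := by rw [← conjTranspose_mul, hV, conjTranspose_zero]
  have hcyc : (ξᴴ * tangentialInv H U * X * (H⁻¹ * U * (Uᴴ * H⁻¹ * U)⁻¹)).trace
      = ((Uᴴ * H⁻¹ * U)⁻¹ * (ξᴴ * tangentialInv H U * X * (H⁻¹ * U))).trace := by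
    rw [← Matrix.mul_assoc, Matrix.trace_mul_comm]
  rw [fromBlocks_conjTranspose, inv_fromBlocks_zero_border hH hu hG]
  simp only [conjTranspose_zero, conjTranspose_mul, hH.eq]
  rw [trace_fromBlocks_variation hVA hAV, trace_tangentialInv_mul (Xᴴ * _ * X), hcyc]
  · simp only [conjTranspose_sub, conjTranspose_mul, hi, Matrix.sub_mul, Matrix.mul_sub,
      Matrix.trace_sub, Matrix.mul_assoc, Matrix.neg_mul, Matrix.trace_neg]
    ring
  · rw [Matrix.mul_assoc H⁻¹, Matrix.mul_assoc V, Matrix.mul_nonsing_inv_cancel_left _ _ hdet,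
      ← Matrix.mul_assoc, hV, Matrix.zero_mul]
  · rw [Matrix.mul_assoc, Matrix.mul_assoc Uᴴ H⁻¹ (H * Vᴴ),
      Matrix.nonsing_inv_mul_cancel_left _ _ hdet, hUV, Matrix.mul_zero]

end TangentialInverse

section PosDef

open scoped ComplexOrder

variable {ι κ 𝕜 : Type*} [Fintype ι] [DecidableEq ι] [Fintype κ] [DecidableEq κ] [RCLike 𝕜]
  {H : Matrix ι ι 𝕜} {U : Matrix ι κ 𝕜}

theorem posSemidef_tangentialInv (hH : H.PosDef) (hG : IsUnit (Uᴴ * H⁻¹ * U)) :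
    (tangentialInv H U).PosSemidef := by
  have h : (tangentialInv H U)ᴴ * H * tangentialInv H U = tangentialInv H U := by
    rw [isHermitian_tangentialInv hH.isHermitian, Matrix.mul_assoc, mul_tangentialInv hH.isUnit,
      Matrix.mul_sub, Matrix.mul_one, Matrix.mul_assoc U, ← Matrix.mul_assoc,
      tangentialInv_mul_border hG, Matrix.zero_mul, sub_zero]
  rw [← h]
  exact hH.posSemidef.conjTranspose_mul_mul_same _

open scoped MatrixOrder in
theorem exists_tangential_frame (hH : H.PosDef) (hG : IsUnit (Uᴴ * H⁻¹ * U)) :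
    ∃ B : Matrix ι ι 𝕜, tangentialInv H U = Bᴴ * B ∧ B * U = 0 := by
  obtain ⟨B, hB⟩ := CStarAlgebra.nonneg_iff_eq_star_mul_self.1
    (posSemidef_tangentialInv hH hG).nonneg
  refine ⟨B, hB, ?_⟩
  rw [← Matrix.conjTranspose_mul_self_mul_eq_zero, ← Matrix.star_eq_conjTranspose, ← hB,
    tangentialInv_mul_border hG]

theorem trace_conj_tangentialInv_le (hH : H.PosDef) (hG : IsUnit (Uᴴ * H⁻¹ * U))
    (X : Matrix ι ι 𝕜) :
    ((Uᴴ * H⁻¹ * U)⁻¹ * ((X * (H⁻¹ * U))ᴴ * tangentialInv H U * (X * (H⁻¹ * U)))).trace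
      ≤ (H⁻¹ * (Xᴴ * tangentialInv H U * X)).trace := by
  obtain ⟨B, hB, -⟩ := exists_tangential_frame hH hG
  have hnonneg :=
    ((posSemidef_tangentialInv hH hG).conjTranspose_mul_mul_same (X * Bᴴ)).trace_nonneg
  have hcyc : ((X * Bᴴ)ᴴ * tangentialInv H U * (X * Bᴴ)).trace
      = (tangentialInv H U * (Xᴴ * tangentialInv H U * X)).trace := by
    rw [← Matrix.mul_assoc _ X, Matrix.trace_mul_comm, hB]
    simp only [conjTranspose_mul, conjTranspose_conjTranspose, Matrix.mul_assoc]
  rw [hcyc, trace_tangentialInv_mul, sub_nonneg] at hnonneg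
  simpa only [conjTranspose_mul, hH.isHermitian.inv.eq, Matrix.mul_assoc] using hnonneg

end PosDef

section Bordered

variable {n : ℕ} {ε δ : ℂ} {v w : Fin n → ℂ} {f : (Fin n → ℂ) → ℂ} {z : Fin n → ℂ}

theorem dz_eq_wirtinger (j : Fin n) : dz j = wirtinger (-I) (Pi.single j 1) := by
  ext f z
  rw [dz, wirtinger, ← Pi.single_smul, smul_eq_mul, smul_eq_mul, smul_eq_mul, mul_one]
  ring

theorem dzbar_eq_wirtinger (j : Fin n) : dzbar j = wirtinger I (Pi.single j 1) := by
  ext f z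
  rw [dzbar, wirtinger, ← Pi.single_smul, smul_eq_mul, smul_eq_mul, smul_eq_mul, mul_one]
  ring

theorem wirtinger_dz_dzbar (hf : ContDiffAt ℝ (3 : ℕ) f z) (i j : Fin n) :
    wirtinger ε v (dz i (dzbar j f)) z = dz i (dzbar j (wirtinger ε v f)) z := by
  rw [dz_eq_wirtinger, dzbar_eq_wirtinger, wirtinger_comm (contDiffAt_wirtinger hf)]
  exact wirtinger_congr (wirtinger_comm_eventuallyEq (by norm_num) hf)

/-- The matrix `[∂²f/∂z_i∂z̄_j]` of mixed second derivatives of a complex-valued function. -/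
def complexHessian (f : (Fin n → ℂ) → ℂ) (z : Fin n → ℂ) : Matrix (Fin n) (Fin n) ℂ :=
  Matrix.of fun i j => dz i (dzbar j f) z

/-- The column `(∂f/∂z_i)`. -/
def gradCol (f : (Fin n → ℂ) → ℂ) (z : Fin n → ℂ) : Matrix (Fin n) Unit ℂ :=
  replicateCol Unit fun i => dz i f z

/-- The row `(∂f/∂z̄_j)`. -/
def gradRow (f : (Fin n → ℂ) → ℂ) (z : Fin n → ℂ) : Matrix Unit (Fin n) ℂ :=
  replicateRow Unit fun j => dzbar j f z

/-- The complex Hessian bordered by the first derivatives; for a real function `r` the Fefferman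
operator is `J(r) = -det` of this matrix. -/
def borderedHessian (f : (Fin n → ℂ) → ℂ) (z : Fin n → ℂ) :
    Matrix (Unit ⊕ Fin n) (Unit ⊕ Fin n) ℂ :=
  fromBlocks (Matrix.of fun _ _ => f z) (gradRow f z) (gradCol f z) (complexHessian f z)

theorem contDiffAt_dz {m : ℕ} (hf : ContDiffAt ℝ (m + 1 : ℕ) f z) (j : Fin n) :
    ContDiffAt ℝ m (dz j f) z :=
  dz_eq_wirtinger j ▸ contDiffAt_wirtinger hf

theorem contDiffAt_dzbar {m : ℕ} (hf : ContDiffAt ℝ (m + 1 : ℕ) f z) (j : Fin n) :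
    ContDiffAt ℝ m (dzbar j f) z :=
  dzbar_eq_wirtinger j ▸ contDiffAt_wirtinger hf

theorem contDiffAt_complexHessian {m : ℕ} (hf : ContDiffAt ℝ (m + 2 : ℕ) f z) :
    ContDiffAt ℝ m (complexHessian f) z :=
  contDiffAt_matrix fun i j => contDiffAt_dz (contDiffAt_dzbar hf j) i

theorem contDiffAt_gradCol {m : ℕ} (hf : ContDiffAt ℝ (m + 1 : ℕ) f z) :
    ContDiffAt ℝ m (gradCol f) z :=
  contDiffAt_matrix fun i _ => contDiffAt_dz hf i

theorem contDiffAt_borderedHessian {m : ℕ} (hf : ContDiffAt ℝ (m + 2 : ℕ) f z) :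
    ContDiffAt ℝ m (borderedHessian f) z := by
  have hf₁ : ContDiffAt ℝ (m + 1 : ℕ) f z := hf.of_le (by norm_cast; lia)
  refine contDiffAt_matrix ?_
  rintro (_ | i) (_ | j)
  · exact hf.of_le (by norm_cast; lia)
  · exact contDiffAt_dzbar hf₁ j
  · exact contDiffAt_dz hf₁ i
  · exact contDiffAt_dz (contDiffAt_dzbar hf j) i

theorem wirtinger_complexHessian (hf : ContDiffAt ℝ (3 : ℕ) f z) :
    wirtinger ε v (complexHessian f) z = complexHessian (wirtinger ε v f) z := by
  ext i j
  rw [wirtinger_matrix_apply ((contDiffAt_complexHessian (m := 1) hf).differentiableAt (by simp))]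
  exact wirtinger_dz_dzbar hf i j

theorem wirtinger_gradCol (hf : ContDiffAt ℝ (2 : ℕ) f z) :
    wirtinger ε v (gradCol f) z = gradCol (wirtinger ε v f) z := by
  ext i _
  rw [wirtinger_matrix_apply ((contDiffAt_gradCol (m := 1) hf).differentiableAt (by simp))]
  simp only [gradCol, replicateCol_apply, dz_eq_wirtinger]
  exact wirtinger_comm hf

theorem wirtinger_borderedHessian (hf : ContDiffAt ℝ (3 : ℕ) f z) :
    wirtinger ε v (borderedHessian f) z = borderedHessian (wirtinger ε v f) z := by
  have hf₂ : ContDiffAt ℝ (2 : ℕ) f z := hf.of_le (by norm_num)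
  ext i j
  rw [wirtinger_matrix_apply ((contDiffAt_borderedHessian (m := 1) hf).differentiableAt (by simp))]
  rcases i with i | i <;> rcases j with j | j
  · rfl
  · simp only [borderedHessian, fromBlocks_apply₁₂, gradRow, replicateRow_apply, dzbar_eq_wirtinger]
    exact wirtinger_comm hf₂
  · simp only [borderedHessian, fromBlocks_apply₂₁, gradCol, replicateCol_apply, dz_eq_wirtinger]
    exact wirtinger_comm hf₂
  · exact wirtinger_dz_dzbar hf i j

theorem wirtinger_wirtinger_complexHessian (hf : ContDiffAt ℝ (4 : ℕ) f z) :
    wirtinger ε v (wirtinger δ w (complexHessian f)) z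
      = complexHessian (wirtinger ε v (wirtinger δ w f)) z := by
  rw [← wirtinger_complexHessian (contDiffAt_wirtinger hf)]
  exact wirtinger_congr ((hf.eventually (by simp)).mono fun _ hy =>
    wirtinger_complexHessian (hy.of_le (by norm_num)))

theorem wirtinger_wirtinger_borderedHessian (hf : ContDiffAt ℝ (4 : ℕ) f z) :
    wirtinger ε v (wirtinger δ w (borderedHessian f)) z
      = borderedHessian (wirtinger ε v (wirtinger δ w f)) z := by
  rw [← wirtinger_borderedHessian (contDiffAt_wirtinger hf)]
  exact wirtinger_congr ((hf.eventually (by simp)).mono fun _ hy =>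
    wirtinger_borderedHessian (hy.of_le (by norm_num)))

theorem star_dz (j : Fin n) : star (dz j f z) = dzbar j (fun y => star (f y)) z := by
  rw [dz_eq_wirtinger, dzbar_eq_wirtinger, star_wirtinger]
  simp

theorem star_dzbar (j : Fin n) : star (dzbar j f z) = dz j (fun y => star (f y)) z := by
  rw [dz_eq_wirtinger, dzbar_eq_wirtinger, star_wirtinger]
  simp

theorem conjTranspose_gradCol : (gradCol f z)ᴴ = gradRow (fun y => star (f y)) z := by
  ext _ j
  exact star_dz j

theorem conjTranspose_gradRow : (gradRow f z)ᴴ = gradCol (fun y => star (f y)) z := by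
  ext i _
  exact star_dzbar i

theorem conjTranspose_complexHessian (hf : ContDiffAt ℝ (2 : ℕ) f z) :
    (complexHessian f z)ᴴ = complexHessian (fun y => star (f y)) z := by
  ext i j
  have hcomm : dz j (dzbar i f) z = dzbar i (dz j f) z := by
    simp only [dz_eq_wirtinger, dzbar_eq_wirtinger, wirtinger_comm hf]
  rw [conjTranspose_apply, complexHessian, of_apply, hcomm, star_dzbar]
  simp only [star_dz]
  rfl

theorem conjTranspose_borderedHessian (hf : ContDiffAt ℝ (2 : ℕ) f z) :
    (borderedHessian f z)ᴴ = borderedHessian (fun y => star (f y)) z := by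
  rw [borderedHessian, fromBlocks_conjTranspose, conjTranspose_gradCol, conjTranspose_gradRow,
    conjTranspose_complexHessian hf]
  rfl

theorem replicateRow_mul_gradCol :
    replicateRow Unit v * gradCol f z = Matrix.of fun _ _ => wirtinger (-I) v f z := by
  ext
  rw [of_apply, wirtinger_neg_I_eq_sum]
  simp only [gradCol, mul_apply, replicateRow_apply, replicateCol_apply, dz_eq_wirtinger,
    smul_eq_mul]

theorem gradRow_wirtinger (hf : ContDiffAt ℝ (2 : ℕ) f z) :
    gradRow (wirtinger (-I) v f) z = replicateRow Unit v * complexHessian f z := by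
  ext i j
  rw [gradRow, replicateRow_apply, dzbar_eq_wirtinger, wirtinger_comm hf, wirtinger_neg_I_eq_sum]
  simp only [mul_apply, replicateRow_apply, complexHessian, of_apply, dz_eq_wirtinger,
    dzbar_eq_wirtinger, smul_eq_mul]

theorem gradCol_wirtinger (hf : ContDiffAt ℝ (2 : ℕ) f z) :
    gradCol (wirtinger I v f) z = complexHessian f z * (replicateRow Unit v)ᴴ := by
  ext i j
  rw [gradCol, replicateCol_apply, dz_eq_wirtinger, wirtinger_comm hf, wirtinger_I_eq_sum]
  simp only [mul_apply, conjTranspose_apply, replicateRow_apply, complexHessian, of_apply,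
    dz_eq_wirtinger, dzbar_eq_wirtinger, smul_eq_mul]
  exact Finset.sum_congr rfl fun k _ => by rw [wirtinger_comm hf, mul_comm]

theorem wirtinger_borderedHessian_of_tangent (hf : ContDiffAt ℝ (3 : ℕ) f z)
    (hv : replicateRow Unit v * gradCol f z = 0) :
    wirtinger (-I) v (borderedHessian f) z
      = fromBlocks 0 (replicateRow Unit v * complexHessian f z)
        (wirtinger (-I) v (gradCol f) z) (wirtinger (-I) v (complexHessian f) z) := by
  have hf₂ : ContDiffAt ℝ (2 : ℕ) f z := hf.of_le (by norm_num)
  rw [wirtinger_borderedHessian hf, borderedHessian, gradRow_wirtinger hf₂,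
    ← replicateRow_mul_gradCol, hv, wirtinger_gradCol hf₂, wirtinger_complexHessian hf]

theorem wirtinger_wirtinger_borderedHessian_eq (hf : ContDiffAt ℝ (4 : ℕ) f z) :
    wirtinger (-I) v (wirtinger I v (borderedHessian f)) z
      = fromBlocks (replicateRow Unit v * complexHessian f z * (replicateRow Unit v)ᴴ)
        (replicateRow Unit v * wirtinger I v (complexHessian f) z)
        (wirtinger (-I) v (complexHessian f) z * (replicateRow Unit v)ᴴ)
        (wirtinger (-I) v (wirtinger I v (complexHessian f)) z) := by
  have hf₃ : ContDiffAt ℝ (3 : ℕ) f z := hf.of_le (by norm_num)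
  have hcol : gradCol (wirtinger (-I) v (wirtinger I v f)) z
      = gradCol (wirtinger I v (wirtinger (-I) v f)) z := by
    ext i j
    simp only [gradCol, replicateCol_apply, dz_eq_wirtinger]
    exact wirtinger_congr (wirtinger_comm_eventuallyEq (by norm_num) hf)
  rw [wirtinger_wirtinger_borderedHessian hf, borderedHessian,
    gradRow_wirtinger (contDiffAt_wirtinger hf₃), hcol,
    gradCol_wirtinger (contDiffAt_wirtinger hf₃), ← replicateRow_mul_gradCol,
    gradCol_wirtinger (hf.of_le (by norm_num)), Matrix.mul_assoc,
    wirtinger_wirtinger_complexHessian hf, wirtinger_complexHessian hf₃,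
    wirtinger_complexHessian hf₃]

theorem conjTranspose_wirtinger_complexHessian (hf : ContDiffAt ℝ (3 : ℕ) f z) :
    (wirtinger ε v (complexHessian f) z)ᴴ
      = wirtinger (star ε) v (complexHessian fun y => star (f y)) z := by
  rw [wirtinger_complexHessian hf, wirtinger_complexHessian (contDiffAt_star hf),
    conjTranspose_complexHessian (contDiffAt_wirtinger hf)]
  exact congrArg (complexHessian · z) (funext fun y => star_wirtinger)

theorem conjTranspose_wirtinger_borderedHessian (hf : ContDiffAt ℝ (3 : ℕ) f z) :
    (wirtinger ε v (borderedHessian f) z)ᴴ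
      = wirtinger (star ε) v (borderedHessian fun y => star (f y)) z := by
  rw [wirtinger_borderedHessian hf, wirtinger_borderedHessian (contDiffAt_star hf),
    conjTranspose_borderedHessian (contDiffAt_wirtinger hf)]
  exact congrArg (borderedHessian · z) (funext fun y => star_wirtinger)

end Bordered

section Contraction

variable {n : ℕ} (v : Fin n → ℂ)

section Module

variable {M : Type*} [AddCommGroup M] [Module ℂ M]

/-- The Hermitian contraction `∑ v_k v̄_l F_{k l̄}`. -/
def contract (F : Fin n → Fin n → M) : M := ∑ k, ∑ l, (v k * star (v l)) • F k l

theorem contract_add (F G : Fin n → Fin n → M) :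
    contract v (fun k l => F k l + G k l) = contract v F + contract v G := by
  simp only [contract, smul_add, Finset.sum_add_distrib]

theorem contract_sub (F G : Fin n → Fin n → M) :
    contract v (fun k l => F k l - G k l) = contract v F - contract v G := by
  simp only [contract, smul_sub, Finset.sum_sub_distrib]

end Module

theorem contract_mul_left (c : ℂ) (F : Fin n → Fin n → ℂ) :
    contract v (fun k l => c * F k l) = c * contract v F := by
  simp only [contract, Finset.mul_sum, smul_eq_mul, mul_left_comm c]

theorem contract_div (F : Fin n → Fin n → ℂ) (c : ℂ) :
    contract v (fun k l => F k l / c) = contract v F / c := by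
  simp only [div_eq_inv_mul, contract_mul_left]

theorem contract_mul_star (x : Fin n → ℂ) :
    contract v (fun k l => x k * star (x l)) = (Complex.normSq (∑ k, v k * x k) : ℂ) := by
  rw [← Complex.mul_conj, contract, map_sum, Finset.sum_mul_sum]
  refine Finset.sum_congr rfl fun k _ => Finset.sum_congr rfl fun l _ => ?_
  rw [map_mul, smul_eq_mul, Complex.star_def]
  ring

theorem contract_trace_mul {ι : Type*} [Fintype ι] (P : Matrix ι ι ℂ)
    (X : Fin n → Fin n → Matrix ι ι ℂ) :
    contract v (fun k l => (P * X k l).trace) = (P * contract v X).trace := by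
  simp only [contract, Matrix.mul_sum, Matrix.trace_sum, Matrix.mul_smul, Matrix.trace_smul]

theorem contract_trace_conj {ι κ : Type*} [Fintype ι] [Fintype κ] (P : Matrix κ κ ℂ)
    (A : Matrix ι ι ℂ) (X : Fin n → Matrix ι κ ℂ) :
    contract v (fun k l => (P * ((X l)ᴴ * A * X k)).trace)
      = (P * ((∑ k, v k • X k)ᴴ * A * ∑ k, v k • X k)).trace := by
  rw [contract_trace_mul]
  simp only [contract, conjTranspose_sum, conjTranspose_smul, Matrix.sum_mul, Matrix.mul_sum,
    Matrix.smul_mul, Matrix.mul_smul, smul_smul, Finset.smul_sum]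

theorem contract_wirtinger {F : Type*} [NormedAddCommGroup F] [NormedSpace ℂ F]
    {f : (Fin n → ℂ) → F} {z : Fin n → ℂ} (hf : ContDiffAt ℝ (2 : ℕ) f z) :
    contract v (fun k l =>
        wirtinger (-I) (Pi.single k 1) (wirtinger I (Pi.single l 1) f) z)
      = wirtinger (-I) v (wirtinger I v f) z := by
  rw [wirtinger_neg_I_eq_sum]
  refine Finset.sum_congr rfl fun k _ => ?_
  rw [wirtinger_comm hf, wirtinger_I_eq_sum, Finset.smul_sum]
  exact Finset.sum_congr rfl fun l _ => by rw [wirtinger_comm hf, smul_smul]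

theorem sum_mul_eq_sum_contract {A B : Matrix (Fin n) (Fin n) ℂ} (hB : A = Bᴴ * B)
    (F : Fin n → Fin n → ℂ) :
    ∑ k, ∑ l, A l k * F k l = ∑ m, contract (B m) F := by
  simp only [hB, Matrix.mul_apply, conjTranspose_apply, Finset.sum_mul, contract, smul_eq_mul,
    mul_comm (star _)]
  exact Finset.sum_comm_cycle

theorem trace_mul_conj_eq_sum {ι κ : Type*} [Fintype ι] [Fintype κ] (P : Matrix κ κ ℂ)
    (A : Matrix ι ι ℂ) (X : Matrix ι κ ℂ) (Y : Matrix κ ι ℂ) :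
    (P * (Y * A * X)).trace = ∑ i, ∑ q, ∑ p, ∑ j, A q i * P j p * X i j * Y p q := by
  simp only [Matrix.trace, diag_apply, Matrix.mul_apply, Finset.mul_sum, Finset.sum_mul]
  rw [Finset.sum_comm_cycle]
  refine Finset.sum_congr rfl fun i _ => ?_
  rw [Finset.sum_comm_cycle]
  refine Finset.sum_congr rfl fun q _ => ?_
  rw [Finset.sum_comm]
  exact Finset.sum_congr rfl fun p _ => Finset.sum_congr rfl fun j _ => by ring

end Contraction

section RealFunction

variable {n : ℕ} {r : (Fin n → ℂ) → ℝ} {z v : Fin n → ℂ}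

theorem star_toC (r : (Fin n → ℂ) → ℝ) : (fun y => star (toC r y)) = toC r :=
  funext fun _ => Complex.conj_ofReal _

theorem conjTranspose_gradCol_toC : (gradCol (toC r) z)ᴴ = gradRow (toC r) z := by
  rw [conjTranspose_gradCol, star_toC]

theorem neg_det_borderedHessian (h : ContDiffAt ℝ (2 : ℕ) (toC r) z) :
    -1 * (borderedHessian (toC r) z).det = (feffermanJ r z : ℂ) := by
  have hreal : star (borderedHessian (toC r) z).det = (borderedHessian (toC r) z).det := by
    rw [← Matrix.det_conjTranspose, conjTranspose_borderedHessian h, star_toC]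
  have hJ : feffermanJ r z = (-(borderedHessian (toC r) z).det).re := rfl
  rw [hJ, Complex.neg_re, Complex.ofReal_neg, Complex.conj_eq_iff_re.1 hreal, neg_one_mul]

theorem gradCol_ne_zero (hd : DifferentiableAt ℝ r z) (h : fderiv ℝ r z ≠ 0) :
    gradCol (toC r) z ≠ 0 := by
  refine fun hzero => h (ContinuousLinearMap.ext fun v => ?_)
  have hv : wirtinger (-I) v (toC r) z = 0 := by
    have hrow := replicateRow_mul_gradCol (v := v) (f := toC r) (z := z)
    rw [hzero, Matrix.mul_zero] at hrow
    exact (congrFun₂ hrow () ()).symm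
  have hfd : HasFDerivAt (toC r) (Complex.ofRealCLM ∘L fderiv ℝ r z) z :=
    Complex.ofRealCLM.hasFDerivAt.comp z hd.hasFDerivAt
  rw [wirtinger_of_hasFDerivAt hfd] at hv
  simpa using congrArg Complex.re hv

theorem rUp_eq (i : Fin n) :
    rUp r z i = ((gradCol (toC r) z)ᴴ * (hess r z)⁻¹) () i := by
  rw [conjTranspose_gradCol_toC]
  simp only [rUp, rInv, Matrix.mul_apply, gradRow, replicateRow_apply, mul_comm]

theorem rUpBar_eq (j : Fin n) : rUpBar r z j = ((hess r z)⁻¹ * gradCol (toC r) z) j () := by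
  simp only [rUpBar, rInv, Matrix.mul_apply, gradCol, replicateCol_apply]

/-- The matrix with entries `a^{j̄ i}`, i.e. the transpose of `[a^{i j̄}[r]]`, at a point where
`r = 0` (see `IsStrictBoundaryPoint.aUp_eq`). -/
def aMatrix (r : (Fin n → ℂ) → ℝ) (z : Fin n → ℂ) : Matrix (Fin n) (Fin n) ℂ :=
  tangentialInv (hess r z) (gradCol (toC r) z)

/-- The matrix `∑ v_k r_{i j̄ k}`, the derivative of the complex Hessian along `v`. -/
def dirHess (r : (Fin n → ℂ) → ℝ) (z v : Fin n → ℂ) : Matrix (Fin n) (Fin n) ℂ :=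
  wirtinger (-I) v (hess r) z

/-- The column `∑ v_k r_{i k}`, the derivative of the complex gradient along `v`. -/
def dirGrad (r : (Fin n → ℂ) → ℝ) (z v : Fin n → ℂ) : Matrix (Fin n) Unit ℂ :=
  wirtinger (-I) v (gradCol (toC r)) z

theorem conjTranspose_dirHess (hr : ContDiffAt ℝ (3 : ℕ) (toC r) z) :
    (dirHess r z v)ᴴ = wirtinger I v (hess r) z := by
  refine (conjTranspose_wirtinger_complexHessian hr).trans ?_
  rw [star_toC, star_neg, Complex.star_def, Complex.conj_I, neg_neg]
  rfl

end RealFunction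

/-- The local hypotheses of the estimates at a boundary point `z` of `{r < 0}`. -/
structure IsStrictBoundaryPoint {n : ℕ} (r : (Fin n → ℂ) → ℝ) (z : Fin n → ℂ) : Prop where
  contDiffAt : ContDiffAt ℝ (4 : ℕ) r z
  eq_zero : r z = 0
  fderiv_ne_zero : fderiv ℝ r z ≠ 0
  posDef : open scoped ComplexOrder in (hess r z).PosDef

namespace IsStrictBoundaryPoint

open scoped ComplexOrder

variable {n : ℕ} {r : (Fin n → ℂ) → ℝ} {z v : Fin n → ℂ}

theorem contDiffAt_toC (h : IsStrictBoundaryPoint r z) : ContDiffAt ℝ (4 : ℕ) (toC r) z :=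
  Complex.ofRealCLM.contDiff.contDiffAt.comp z h.contDiffAt

theorem gradSq_pos_and_form_eq (h : IsStrictBoundaryPoint r z) :
    0 < gradSq r z ∧ (gradCol (toC r) z)ᴴ * (hess r z)⁻¹ * gradCol (toC r) z
      = (gradSq r z : ℂ) • 1 := by
  have hne : (fun i => dz i (toC r) z) ≠ 0 := fun h0 =>
    gradCol_ne_zero (h.contDiffAt.differentiableAt (by simp)) h.fderiv_ne_zero (by
      rw [gradCol, h0]
      rfl)
  have hform : ((gradCol (toC r) z)ᴴ * (hess r z)⁻¹ * gradCol (toC r) z) () ()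
      = ∑ i, ∑ j, rInv r z i j * dz i (toC r) z * dzbar j (toC r) z := by
    rw [conjTranspose_gradCol_toC]
    simp only [gradRow, gradCol, Matrix.mul_apply, replicateRow_apply, replicateCol_apply,
      Finset.sum_mul, rInv]
    exact Finset.sum_congr rfl fun i _ => Finset.sum_congr rfl fun j _ => by ring
  have hpos : 0 < ((gradCol (toC r) z)ᴴ * (hess r z)⁻¹ * gradCol (toC r) z) () () := by
    rw [Matrix.mul_assoc]
    exact h.posDef.inv.dotProduct_mulVec_pos hne
  rw [hform, Complex.lt_def] at hpos
  refine ⟨hpos.1, ?_⟩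
  ext ⟨⟩ ⟨⟩
  rw [hform, Matrix.smul_apply, Matrix.one_apply_eq, smul_eq_mul, mul_one]
  exact Complex.ext rfl hpos.2.symm

theorem gradSq_pos (h : IsStrictBoundaryPoint r z) : 0 < gradSq r z :=
  h.gradSq_pos_and_form_eq.1

theorem isUnit_form (h : IsStrictBoundaryPoint r z) :
    IsUnit ((gradCol (toC r) z)ᴴ * (hess r z)⁻¹ * gradCol (toC r) z) := by
  rw [h.gradSq_pos_and_form_eq.2, Matrix.isUnit_iff_isUnit_det]
  simpa using h.gradSq_pos.ne'

theorem inv_form (h : IsStrictBoundaryPoint r z) :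
    ((gradCol (toC r) z)ᴴ * (hess r z)⁻¹ * gradCol (toC r) z)⁻¹ = (gradSq r z : ℂ)⁻¹ • 1 := by
  rw [h.gradSq_pos_and_form_eq.2]
  have := Complex.ofReal_ne_zero.2 h.gradSq_pos.ne'
  refine Matrix.inv_eq_right_inv ?_
  rw [smul_mul_smul_comm, mul_inv_cancel₀ this, Matrix.one_mul, one_smul]

theorem trace_inv_form_mul (h : IsStrictBoundaryPoint r z) (X : Matrix Unit Unit ℂ) :
    (((gradCol (toC r) z)ᴴ * (hess r z)⁻¹ * gradCol (toC r) z)⁻¹ * X).trace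
      = (gradSq r z : ℂ)⁻¹ * X.trace := by
  rw [h.inv_form, Matrix.smul_mul, Matrix.one_mul, Matrix.trace_smul, smul_eq_mul]

theorem aUp_eq (h : IsStrictBoundaryPoint r z) (i j : Fin n) :
    aUp r z i j = aMatrix r z j i := by
  rw [aUp, h.eq_zero, neg_zero, zero_add, aMatrix, tangentialInv, Matrix.sub_apply, h.inv_form,
    Matrix.mul_smul, Matrix.mul_one, Matrix.smul_mul, Matrix.smul_apply,
    Matrix.mul_apply (M := _ * gradCol (toC r) z)]
  simp only [Finset.univ_unique, PUnit.default_eq_unit, Finset.sum_singleton, rUp_eq, rUpBar_eq,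
    smul_eq_mul, rInv]
  ring

theorem borderedHessian_eq (h : IsStrictBoundaryPoint r z) :
    borderedHessian (toC r) z
      = fromBlocks 0 (gradCol (toC r) z)ᴴ (gradCol (toC r) z) (hess r z) := by
  rw [borderedHessian, ← conjTranspose_gradCol_toC]
  congr 1
  ext
  simp [toC, h.eq_zero]

theorem feffermanJ_pos (h : IsStrictBoundaryPoint r z) : 0 < feffermanJ r z := by
  have hJ : (feffermanJ r z : ℂ) = (hess r z).det * gradSq r z := by
    let := h.posDef.isUnit.invertible
    rw [← neg_det_borderedHessian (h.contDiffAt_toC.of_le (by norm_num)), h.borderedHessian_eq,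
      Matrix.det_fromBlocks₂₂, Matrix.invOf_eq_nonsing_inv, h.gradSq_pos_and_form_eq.2]
    simp
  rw [← Complex.zero_lt_real, hJ]
  exact mul_pos h.posDef.det_pos (Complex.zero_lt_real.2 h.gradSq_pos)

theorem contDiffAt_borderedHessian (h : IsStrictBoundaryPoint r z) :
    ContDiffAt ℝ (2 : ℕ) (borderedHessian (toC r)) z :=
  Fefferman.contDiffAt_borderedHessian h.contDiffAt_toC

theorem neg_det_mem_slitPlane (h : IsStrictBoundaryPoint r z) :
    -1 * (borderedHessian (toC r) z).det ∈ slitPlane := by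
  rw [neg_det_borderedHessian (h.contDiffAt_toC.of_le (by norm_num))]
  exact Complex.ofReal_mem_slitPlane.2 h.feffermanJ_pos

theorem toC_logJ_eventuallyEq (h : IsStrictBoundaryPoint r z) :
    toC (logJ r) =ᶠ[𝓝 z] fun y => Complex.log (-1 * (borderedHessian (toC r) y).det) := by
  have hslit : ∀ᶠ y in 𝓝 z, -1 * (borderedHessian (toC r) y).det ∈ slitPlane :=
    (((hasFDerivAt_det _).continuousAt.comp h.contDiffAt_borderedHessian.continuousAt).const_mul
      (-1)).eventually (Complex.isOpen_slitPlane.mem_nhds h.neg_det_mem_slitPlane)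
  filter_upwards [hslit, h.contDiffAt_toC.eventually (by simp)] with y hy hr
  rw [neg_det_borderedHessian (hr.of_le (by norm_num)), Complex.ofReal_mem_slitPlane] at hy
  rw [neg_det_borderedHessian (hr.of_le (by norm_num)), toC, logJ, Complex.ofReal_log hy.le]

theorem contDiffAt_toC_logJ (h : IsStrictBoundaryPoint r z) :
    ContDiffAt ℝ (2 : ℕ) (toC (logJ r)) z := by
  have hlog := (Complex.contDiffAt_log (n := (2 : ℕ)) h.neg_det_mem_slitPlane).restrict_scalars ℝ
  refine ContDiffAt.congr_of_eventuallyEq ?_ h.toC_logJ_eventuallyEq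
  exact hlog.comp z (contDiffAt_const.mul (contDiffAt_det h.contDiffAt_borderedHessian))

theorem wirtinger_logJ (h : IsStrictBoundaryPoint r z)
    (hv : replicateRow Unit v * gradCol (toC r) z = 0) :
    wirtinger (-I) v (toC (logJ r)) z
      = (aMatrix r z * dirHess r z v).trace
        + (gradSq r z : ℂ)⁻¹ * ((gradCol (toC r) z)ᴴ * (hess r z)⁻¹ * dirGrad r z v).trace := by
  rw [wirtinger_congr h.toC_logJ_eventuallyEq, wirtinger_log_mul_det
      (h.contDiffAt_borderedHessian.differentiableAt (by simp)) h.neg_det_mem_slitPlane,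
    wirtinger_borderedHessian_of_tangent (h.contDiffAt_toC.of_le (by norm_num)) hv,
    h.borderedHessian_eq, ← h.trace_inv_form_mul]
  exact trace_inv_bordered_mul h.posDef.isHermitian h.posDef.isUnit h.isUnit_form hv _ _

theorem wirtinger_wirtinger_logJ (h : IsStrictBoundaryPoint r z)
    (hv : replicateRow Unit v * gradCol (toC r) z = 0) :
    wirtinger (-I) v (wirtinger I v (toC (logJ r))) z
      = (aMatrix r z * wirtinger (-I) v (wirtinger I v (hess r)) z).trace
        + (gradSq r z : ℂ)⁻¹ *
          ((dirGrad r z v - dirHess r z v * ((hess r z)⁻¹ * gradCol (toC r) z))ᴴ * aMatrix r z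
            * (dirGrad r z v - dirHess r z v * ((hess r z)⁻¹ * gradCol (toC r) z))).trace
        - ((hess r z)⁻¹ * ((dirHess r z v)ᴴ * aMatrix r z * dirHess r z v)).trace := by
  have hr : ContDiffAt ℝ (3 : ℕ) (toC r) z := h.contDiffAt_toC.of_le (by norm_num)
  have hbordered : wirtinger I v (borderedHessian (toC r)) z
      = (wirtinger (-I) v (borderedHessian (toC r)) z)ᴴ := by
    rw [conjTranspose_wirtinger_borderedHessian hr, star_toC, star_neg, Complex.star_def,
      Complex.conj_I, neg_neg]
  rw [wirtinger_congr (wirtinger_eventuallyEq h.toC_logJ_eventuallyEq),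
    wirtinger_wirtinger_log_mul_det h.contDiffAt_borderedHessian h.neg_det_mem_slitPlane,
    hbordered, wirtinger_borderedHessian_of_tangent hr hv,
    wirtinger_wirtinger_borderedHessian_eq h.contDiffAt_toC, h.borderedHessian_eq,
    ← h.trace_inv_form_mul]
  refine Eq.trans ?_ (trace_second_variation h.posDef.isHermitian h.posDef.isUnit h.isUnit_form hv
    (dirGrad r z v) (dirHess r z v) _)
  rw [conjTranspose_dirHess hr]
  rfl

end IsStrictBoundaryPoint

section IndexNotation

variable {n : ℕ} {r : (Fin n → ℂ) → ℝ} {z v : Fin n → ℂ}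

theorem dirHess_eq_sum : dirHess r z v = ∑ k, v k • dirHess r z (Pi.single k 1) :=
  wirtinger_neg_I_eq_sum _ _

theorem dirGrad_eq_sum : dirGrad r z v = ∑ k, v k • dirGrad r z (Pi.single k 1) :=
  wirtinger_neg_I_eq_sum _ _

theorem r3_eq (hr : ContDiffAt ℝ (3 : ℕ) (toC r) z) (i j k : Fin n) :
    r3 r z i j k = dirHess r z (Pi.single k 1) i j := by
  have hH : ContDiffAt ℝ (1 : ℕ) (hess r) z := contDiffAt_complexHessian hr
  rw [dirHess, wirtinger_matrix_apply (hH.differentiableAt (by simp)), r3, dz_eq_wirtinger]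
  rfl

theorem r3bar_eq (hr : ContDiffAt ℝ (3 : ℕ) (toC r) z) (p q l : Fin n) :
    r3bar r z p q l = (dirHess r z (Pi.single l 1))ᴴ p q := by
  have hH : ContDiffAt ℝ (1 : ℕ) (hess r) z := contDiffAt_complexHessian hr
  rw [conjTranspose_dirHess hr, wirtinger_matrix_apply (hH.differentiableAt (by simp)), r3bar,
    dzbar_eq_wirtinger]
  rfl

theorem r2_eq (hr : ContDiffAt ℝ (2 : ℕ) (toC r) z) (i k : Fin n) :
    r2 r z i k = dirGrad r z (Pi.single k 1) i () := by
  have hg : ContDiffAt ℝ (1 : ℕ) (gradCol (toC r)) z := contDiffAt_gradCol hr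
  rw [dirGrad, wirtinger_matrix_apply (hg.differentiableAt (by simp)), r2, dz_eq_wirtinger]
  rfl

theorem star_dz_toC (k : Fin n) (s : (Fin n → ℂ) → ℝ) :
    star (dz k (toC s) z) = dzbar k (toC s) z := by
  rw [star_dz, star_toC]

theorem r2bar_eq (q l : Fin n) : r2bar r z q l = star (r2 r z q l) := by
  rw [r2, star_dz, r2bar]
  simp only [star_dz_toC]

theorem sum_mul_sum_rUp_mul_r2 (hr : ContDiffAt ℝ (2 : ℕ) (toC r) z) :
    ∑ k, v k * ∑ i, rUp r z i * r2 r z i k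
      = ((gradCol (toC r) z)ᴴ * (hess r z)⁻¹ * dirGrad r z v).trace := by
  rw [dirGrad_eq_sum, Matrix.mul_sum, Matrix.trace_sum]
  refine Finset.sum_congr rfl fun k _ => ?_
  rw [Matrix.mul_smul, Matrix.trace_smul, smul_eq_mul, Matrix.trace,
    Fintype.sum_unique (ι := Unit), diag_apply, Matrix.mul_apply (i := default)]
  simp only [r2_eq hr, rUp_eq, PUnit.default_eq_unit]

end IndexNotation

namespace IsStrictBoundaryPoint

open scoped ComplexOrder

variable {n : ℕ} {r : (Fin n → ℂ) → ℝ} {z v : Fin n → ℂ}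

theorem lapTilde_eq_trace (h : IsStrictBoundaryPoint r z) (f : (Fin n → ℂ) → ℂ) :
    lapTilde r f z = (aMatrix r z * complexHessian f z).trace := by
  simp only [lapTilde, h.aUp_eq, Matrix.trace, diag_apply, Matrix.mul_apply]
  exact Finset.sum_comm

theorem lapTilde_dz (h : IsStrictBoundaryPoint r z) (k : Fin n) :
    lapTilde r (dz k (toC r)) z = (aMatrix r z * dirHess r z (Pi.single k 1)).trace := by
  rw [h.lapTilde_eq_trace, dz_eq_wirtinger,
    ← wirtinger_complexHessian (h.contDiffAt_toC.of_le (by norm_num))]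
  rfl

theorem lapTilde_dzbar (h : IsStrictBoundaryPoint r z) (l : Fin n) :
    lapTilde r (dzbar l (toC r)) z = star (lapTilde r (dz l (toC r)) z) := by
  have hr : ContDiffAt ℝ (3 : ℕ) (toC r) z := h.contDiffAt_toC.of_le (by norm_num)
  rw [h.lapTilde_dz, ← Matrix.trace_conjTranspose, conjTranspose_mul, conjTranspose_dirHess hr,
    aMatrix, isHermitian_tangentialInv h.posDef.isHermitian, Matrix.trace_mul_comm, ← aMatrix,
    h.lapTilde_eq_trace, dzbar_eq_wirtinger, ← wirtinger_complexHessian hr]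
  rfl

theorem sum_mul_lapTilde_dz (h : IsStrictBoundaryPoint r z) :
    ∑ k, v k * lapTilde r (dz k (toC r)) z = (aMatrix r z * dirHess r z v).trace := by
  rw [dirHess_eq_sum, Matrix.mul_sum, Matrix.trace_sum]
  simp only [h.lapTilde_dz, Matrix.mul_smul, Matrix.trace_smul, smul_eq_mul]

theorem contract_lapTilde (h : IsStrictBoundaryPoint r z) :
    contract v (fun k l => lapTilde r (dz k (dzbar l (toC r))) z)
      = (aMatrix r z * wirtinger (-I) v (wirtinger I v (hess r)) z).trace := by
  have hH : ContDiffAt ℝ (2 : ℕ) (hess r) z := contDiffAt_complexHessian h.contDiffAt_toC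
  rw [← contract_wirtinger v hH, ← contract_trace_mul]
  simp only [h.lapTilde_eq_trace, dz_eq_wirtinger, dzbar_eq_wirtinger,
    ← wirtinger_wirtinger_complexHessian h.contDiffAt_toC]
  rfl

theorem contract_rInv (h : IsStrictBoundaryPoint r z) :
    contract v (fun k l => ∑ i, ∑ q, ∑ p, ∑ j,
        aUp r z i q * rInv r z p j * r3 r z i j k * r3bar r z p q l)
      = ((hess r z)⁻¹ * ((dirHess r z v)ᴴ * aMatrix r z * dirHess r z v)).trace := by
  have hr : ContDiffAt ℝ (3 : ℕ) (toC r) z := h.contDiffAt_toC.of_le (by norm_num)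
  rw [dirHess_eq_sum, ← contract_trace_conj]
  simp only [trace_mul_conj_eq_sum, h.aUp_eq, r3_eq hr, r3bar_eq hr]
  rfl

theorem star_rUpBar (h : IsStrictBoundaryPoint r z) (j : Fin n) :
    star (rUpBar r z j) = rUp r z j := by
  have hi : (hess r z)⁻¹ᴴ = (hess r z)⁻¹ := h.posDef.isHermitian.inv
  rw [rUpBar_eq, rUp_eq, ← conjTranspose_apply, conjTranspose_mul, hi]

theorem contract_rUp (h : IsStrictBoundaryPoint r z) :
    contract v (fun k l => ∑ i, ∑ q, ∑ p, ∑ j,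
        aUp r z i q * rUp r z p * rUpBar r z j * r3 r z i j k * r3bar r z p q l)
      = ((dirHess r z v * ((hess r z)⁻¹ * gradCol (toC r) z))ᴴ * aMatrix r z
          * (dirHess r z v * ((hess r z)⁻¹ * gradCol (toC r) z))).trace := by
  have hr : ContDiffAt ℝ (3 : ℕ) (toC r) z := h.contDiffAt_toC.of_le (by norm_num)
  have hK : ∀ p j, rUp r z p * rUpBar r z j = ((hess r z)⁻¹ * gradCol (toC r) z
      * ((hess r z)⁻¹ * gradCol (toC r) z)ᴴ) j p := fun p j => by
    rw [Matrix.mul_apply, Fintype.sum_unique, conjTranspose_apply, PUnit.default_eq_unit,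
      ← rUpBar_eq, ← rUpBar_eq, h.star_rUpBar, mul_comm]
  have hcycle : ∀ (Y : Matrix (Fin n) (Fin n) ℂ) (K : Matrix (Fin n) Unit ℂ),
      ((Y * K)ᴴ * aMatrix r z * (Y * K)).trace
        = (K * Kᴴ * (Yᴴ * aMatrix r z * Y)).trace := fun Y K => by
    rw [conjTranspose_mul, ← Matrix.mul_assoc _ Y, Matrix.trace_mul_comm]
    simp only [Matrix.mul_assoc]
  rw [hcycle, dirHess_eq_sum, ← contract_trace_conj]
  simp only [trace_mul_conj_eq_sum, h.aUp_eq, r3_eq hr, r3bar_eq hr, mul_assoc _ (rUp r z _), hK]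

theorem contract_r2 (h : IsStrictBoundaryPoint r z) :
    contract v (fun k l => ∑ i, ∑ q, aUp r z i q * r2 r z i k * r2bar r z q l)
      = ((dirGrad r z v)ᴴ * aMatrix r z * dirGrad r z v).trace := by
  have hr : ContDiffAt ℝ (2 : ℕ) (toC r) z := h.contDiffAt_toC.of_le (by norm_num)
  rw [dirGrad_eq_sum, ← Matrix.one_mul (_ * _), ← contract_trace_conj]
  simp only [trace_mul_conj_eq_sum, h.aUp_eq, r2_eq hr, r2bar_eq, Fintype.sum_unique,
    PUnit.default_eq_unit, Matrix.one_apply_eq, mul_one, conjTranspose_apply]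

theorem contract_dz_dzbar_logJ (h : IsStrictBoundaryPoint r z) :
    contract v (fun k l => dz k (dzbar l (toC (logJ r))) z)
      = wirtinger (-I) v (wirtinger I v (toC (logJ r))) z := by
  simp only [← contract_wirtinger v h.contDiffAt_toC_logJ, dz_eq_wirtinger, dzbar_eq_wirtinger]

end IsStrictBoundaryPoint

theorem mul_normSq_add_le {t : ℝ} (ht : 0 ≤ t) (p q : ℂ) :
    t / (t + 1) * normSq (p + q) ≤ normSq p + t * normSq q := by
  have hdiff : normSq p + t * normSq q - t / (t + 1) * normSq (p + q)
      = normSq (p - t * q) / (t + 1) := by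
    simp only [normSq_apply, add_re, add_im, sub_re, sub_im, re_ofReal_mul, im_ofReal_mul]
    field_simp
    ring
  have hnonneg : 0 ≤ normSq (p - t * q) / (t + 1) := div_nonneg (normSq_nonneg _) (by positivity)
  linarith

section TraceForm

open scoped ComplexOrder

variable {ι κ : Type*} [Fintype ι] [Fintype κ] {A : Matrix ι ι ℂ}

theorem re_trace_conj_nonneg (hA : A.PosSemidef) (X : Matrix ι κ ℂ) :
    0 ≤ (Xᴴ * A * X).trace.re :=
  (Complex.nonneg_iff.1 (hA.conjTranspose_mul_mul_same X).trace_nonneg).1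

theorem re_trace_conj_sub_le (hA : A.PosSemidef) (X Y : Matrix ι κ ℂ) :
    ((X - Y)ᴴ * A * (X - Y)).trace.re
      ≤ 2 * (Xᴴ * A * X).trace.re + 2 * (Yᴴ * A * Y).trace.re := by
  have hparallelogram : ((X - Y)ᴴ * A * (X - Y)).trace.re + ((X + Y)ᴴ * A * (X + Y)).trace.re
      = 2 * (Xᴴ * A * X).trace.re + 2 * (Yᴴ * A * Y).trace.re := by
    simp only [conjTranspose_sub, conjTranspose_add, Matrix.sub_mul, Matrix.mul_sub,
      Matrix.add_mul, Matrix.mul_add, Matrix.trace_sub, Matrix.trace_add, sub_re, add_re]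
    ring
  linarith [re_trace_conj_nonneg hA (X + Y)]

end TraceForm

section Forms

variable {n : ℕ}

/-- The bracket contracted with `a^{k l̄}` in the lower estimate. -/
def lowerForm (r : (Fin n → ℂ) → ℝ) (z : Fin n → ℂ) (k l : Fin n) : ℂ :=
  lapTilde r (dz k (dzbar l (toC r))) z
    - (∑ i, ∑ q, ∑ p, ∑ j, aUp r z i q * rInv r z p j * r3 r z i j k * r3bar r z p q l)
    - lapTilde r (dz k (toC r)) z * lapTilde r (dzbar l (toC r)) z
    - n * ((∑ i, rUp r z i * r2 r z i k) * (∑ j, rUpBar r z j * r2bar r z j l))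
        / (gradSq r z : ℂ) ^ 2

/-- The bracket contracted with `a^{k l̄}` in the upper estimate. -/
def upperForm (r : (Fin n → ℂ) → ℝ) (z : Fin n → ℂ) (k l : Fin n) : ℂ :=
  lapTilde r (dz k (dzbar l (toC r))) z
    + (∑ i, ∑ q, ∑ p, ∑ j,
        aUp r z i q * rUp r z p * rUpBar r z j * r3 r z i j k * r3bar r z p q l)
        / (gradSq r z : ℂ)
    + 2 * (∑ i, ∑ q, aUp r z i q * r2 r z i k * r2bar r z q l) / (gradSq r z : ℂ)

/-- The real form `v ↦ ∂_v ∂̄_v log J - n/(n+1) |∂_v log J|²`, whose trace with respect to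
`a^{k l̄}` is the part of the bracket of `Ẽ(r)` that involves `log J`. -/
def logJForm (r : (Fin n → ℂ) → ℝ) (z v : Fin n → ℂ) : ℝ :=
  (wirtinger (-I) v (wirtinger I v (toC (logJ r))) z).re
    - n / (n + 1) * normSq (wirtinger (-I) v (toC (logJ r)) z)

end Forms

namespace IsStrictBoundaryPoint

open scoped ComplexOrder

variable {n : ℕ} {r : (Fin n → ℂ) → ℝ} {z v : Fin n → ℂ}

theorem posSemidef_aMatrix (h : IsStrictBoundaryPoint r z) : (aMatrix r z).PosSemidef :=
  posSemidef_tangentialInv h.posDef h.isUnit_form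

theorem contract_lowerForm (h : IsStrictBoundaryPoint r z) :
    contract v (lowerForm r z)
      = (aMatrix r z * wirtinger (-I) v (wirtinger I v (hess r)) z).trace
        - ((hess r z)⁻¹ * ((dirHess r z v)ᴴ * aMatrix r z * dirHess r z v)).trace
        - normSq (aMatrix r z * dirHess r z v).trace
        - n * normSq ((gradCol (toC r) z)ᴴ * (hess r z)⁻¹ * dirGrad r z v).trace
            / (gradSq r z : ℂ) ^ 2 := by
  have hstar : ∀ l, ∑ j, rUpBar r z j * r2bar r z j l
      = star (∑ i, rUp r z i * r2 r z i l) := fun l => by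
    simp only [star_sum, star_mul', r2bar_eq, ← h.star_rUpBar, star_star]
  unfold lowerForm
  simp only [contract_sub, contract_div, contract_mul_left, hstar, h.lapTilde_dzbar,
    contract_mul_star, h.contract_lapTilde, h.contract_rInv, h.sum_mul_lapTilde_dz,
    sum_mul_sum_rUp_mul_r2 (h.contDiffAt_toC.of_le (by norm_num))]

theorem contract_upperForm (h : IsStrictBoundaryPoint r z) :
    contract v (upperForm r z)
      = (aMatrix r z * wirtinger (-I) v (wirtinger I v (hess r)) z).trace
        + ((dirHess r z v * ((hess r z)⁻¹ * gradCol (toC r) z))ᴴ * aMatrix r z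
            * (dirHess r z v * ((hess r z)⁻¹ * gradCol (toC r) z))).trace / gradSq r z
        + 2 * ((dirGrad r z v)ᴴ * aMatrix r z * dirGrad r z v).trace / gradSq r z := by
  unfold upperForm
  simp only [contract_add, contract_div, contract_mul_left, h.contract_lapTilde, h.contract_rUp,
    h.contract_r2]

theorem re_contract_lowerForm_le (h : IsStrictBoundaryPoint r z)
    (hv : replicateRow Unit v * gradCol (toC r) z = 0) :
    (contract v (lowerForm r z)).re ≤ logJForm r z v := by
  have hgrad := re_trace_conj_nonneg h.posSemidef_aMatrix
    (dirGrad r z v - dirHess r z v * ((hess r z)⁻¹ * gradCol (toC r) z))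
  rw [h.contract_lowerForm, logJForm, h.wirtinger_logJ hv, h.wirtinger_wirtinger_logJ hv]
  have hscalar := mul_normSq_add_le n.cast_nonneg (aMatrix r z * dirHess r z v).trace
    ((gradSq r z : ℂ)⁻¹ * ((gradCol (toC r) z)ᴴ * (hess r z)⁻¹ * dirGrad r z v).trace)
  rw [normSq_mul, normSq_inv, normSq_ofReal] at hscalar
  simp only [← ofReal_inv, ← ofReal_natCast, ← ofReal_pow, ← ofReal_mul, ← ofReal_div, sub_re,
    add_re, ofReal_re, re_ofReal_mul] at hscalar ⊢
  have hcoeff (t : ℝ) : n * t / gradSq r z ^ 2 = n * ((gradSq r z * gradSq r z)⁻¹ * t) := by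
    ring
  rw [hcoeff]
  linarith [mul_nonneg (inv_nonneg.2 h.gradSq_pos.le) hgrad]

theorem logJForm_le_re_contract_upperForm (h : IsStrictBoundaryPoint r z)
    (hv : replicateRow Unit v * gradCol (toC r) z = 0) :
    logJForm r z v ≤ (contract v (upperForm r z)).re := by
  have hgrad := re_trace_conj_sub_le h.posSemidef_aMatrix (dirGrad r z v)
    (dirHess r z v * ((hess r z)⁻¹ * gradCol (toC r) z))
  have hthird := (Complex.le_def.1 <|
    trace_conj_tangentialInv_le h.posDef h.isUnit_form (dirHess r z v)).1
  have hnormSq : 0 ≤ n / (n + 1) * normSq (wirtinger (-I) v (toC (logJ r)) z) :=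
    mul_nonneg (by positivity) (normSq_nonneg _)
  rw [h.trace_inv_form_mul, ← aMatrix, ← ofReal_inv, re_ofReal_mul] at hthird
  rw [h.contract_upperForm, logJForm, h.wirtinger_wirtinger_logJ hv, ← ofReal_inv]
  simp only [sub_re, add_re, div_ofReal_re, mul_re, re_ofNat, im_ofNat, ofReal_re, ofReal_im,
    zero_mul, sub_zero]
  have hscaled := mul_le_mul_of_nonneg_left hgrad (inv_nonneg.2 h.gradSq_pos.le)
  rw [div_eq_inv_mul _ (gradSq r z), div_eq_inv_mul _ (gradSq r z)]
  linarith

end IsStrictBoundaryPoint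

theorem isStrictBoundaryPoint_of_mem_frontier {n : ℕ} {D : Set (Fin n → ℂ)} (hDo : IsOpen D)
    {r : (Fin n → ℂ) → ℝ} (hr : IsDefiningFunction 4 D r) (hpsh : StrictlyPSHOn r (frontier D))
    {z : Fin n → ℂ} (hz : z ∈ frontier D) : IsStrictBoundaryPoint r z := by
  obtain ⟨U, hU, hDU, hrU, hD, hdr⟩ := hr
  have hzU : z ∈ U := hDU (frontier_subset_closure hz)
  have hrz : ContDiffAt ℝ (4 : ℕ) r z := hrU.contDiffAt (hU.mem_nhds hzU)
  have hzD : z ∉ D := by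
    rw [hDo.frontier_eq] at hz
    exact hz.2
  have hle : r z ≤ 0 := by
    have : (𝓝[D] z).NeBot := mem_closure_iff_nhdsWithin_neBot.1 (frontier_subset_closure hz)
    refine le_of_tendsto (hrz.continuousAt.mono_left (nhdsWithin_le_nhds (s := D))) ?_
    filter_upwards [self_mem_nhdsWithin] with y hy
    rw [hD] at hy
    exact hy.2.le
  exact ⟨hrz, hle.antisymm (not_lt.1 fun hlt => hzD (hD ▸ ⟨hzU, hlt⟩)), hdr z hz, hpsh z hz⟩

theorem Etilde_eq {n : ℕ} {r : (Fin n → ℂ) → ℝ} {z : Fin n → ℂ} (hn : n ≠ 0)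
    (hg : gradSq r z ≠ 0) :
    Etilde r z = gradSq r z / (n * (n + 1)) *
        ((lapTilde r (toC (logJ r)) z).re
          - n / (n + 1) * (gradTildeSq r (toC (logJ r)) z).re)
      - 2 * (∑ k, rUp r z k * lapTilde r (dz k (toC r)) z).re / (n + 1) := by
  rw [Etilde, Complex.div_ofReal_re]
  field_simp

namespace IsStrictBoundaryPoint

variable {n : ℕ} {r : (Fin n → ℂ) → ℝ} {z : Fin n → ℂ}

theorem dimension_ne_zero (h : IsStrictBoundaryPoint r z) : n ≠ 0 := by
  rintro rfl
  exact h.fderiv_ne_zero (Subsingleton.elim _ _)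

theorem exists_frame (h : IsStrictBoundaryPoint r z) :
    ∃ B : Matrix (Fin n) (Fin n) ℂ, (∀ m, replicateRow Unit (B m) * gradCol (toC r) z = 0) ∧
      ∀ F : Fin n → Fin n → ℂ, ∑ k, ∑ l, aUp r z k l * F k l = ∑ m, contract (B m) F := by
  obtain ⟨B, hB, hBu⟩ := exists_tangential_frame h.posDef h.isUnit_form
  refine ⟨B, fun m => Matrix.ext fun _ j => congrFun₂ hBu m j, fun F => ?_⟩
  simp only [h.aUp_eq]
  exact sum_mul_eq_sum_contract hB F

theorem lapTilde_sub_gradTildeSq_logJ (h : IsStrictBoundaryPoint r z)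
    {B : Matrix (Fin n) (Fin n) ℂ}
    (hB : ∀ F : Fin n → Fin n → ℂ, ∑ k, ∑ l, aUp r z k l * F k l = ∑ m, contract (B m) F) :
    (lapTilde r (toC (logJ r)) z).re - n / (n + 1) * (gradTildeSq r (toC (logJ r)) z).re
      = ∑ m, logJForm r z (B m) := by
  have hgrad : ∀ v, contract v (fun k l => dz k (toC (logJ r)) z * dzbar l (toC (logJ r)) z)
      = normSq (wirtinger (-I) v (toC (logJ r)) z) := fun v => by
    simp only [← star_dz_toC, contract_mul_star, wirtinger_neg_I_eq_sum v, dz_eq_wirtinger,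
      smul_eq_mul]
  simp only [lapTilde, gradTildeSq, mul_assoc, hB, h.contract_dz_dzbar_logJ, hgrad, re_sum,
    ofReal_re, Finset.mul_sum, ← Finset.sum_sub_distrib, logJForm]

end IsStrictBoundaryPoint

theorem proposition4p2_general {n : ℕ} {r : (Fin n → ℂ) → ℝ} {z : Fin n → ℂ}
    (h : IsStrictBoundaryPoint r z) :
    gradSq r z / (n * (n + 1)) * (∑ k, ∑ l, aUp r z k l * lowerForm r z k l).re
        - 2 * (∑ k, rUp r z k * lapTilde r (dz k (toC r)) z).re / (n + 1) ≤ Etilde r z ∧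
      Etilde r z ≤ gradSq r z / (n * (n + 1)) * (∑ k, ∑ l, aUp r z k l * upperForm r z k l).re
        - 2 * (∑ k, rUp r z k * lapTilde r (dz k (toC r)) z).re / (n + 1) := by
  obtain ⟨B, hBu, hB⟩ := h.exists_frame
  have hcoeff : 0 ≤ gradSq r z / (n * (n + 1)) := div_nonneg h.gradSq_pos.le (by positivity)
  have hsum (F : Fin n → Fin n → ℂ) :
      (∑ k, ∑ l, aUp r z k l * F k l).re = ∑ m, (contract (B m) F).re := by
    rw [hB, re_sum]
  rw [Etilde_eq h.dimension_ne_zero h.gradSq_pos.ne', h.lapTilde_sub_gradTildeSq_logJ hB, hsum,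
    hsum]
  constructor <;> gcongr with m
  · exact h.re_contract_lowerForm_le (hBu m)
  · exact h.logJForm_le_re_contract_upperForm (hBu m)

end Fefferman

end

open Fefferman in
theorem proposition4p2 {n : ℕ} (D : Set (Fin n → ℂ)) (hDo : IsOpen D) (hDc : IsConnected D)
    (hDb : Bornology.IsBounded D) (r : (Fin n → ℂ) → ℝ) (hr : IsDefiningFunction 4 D r)
    (hpsh : StrictlyPSHOn r (frontier D)) (z : Fin n → ℂ) (hz : z ∈ frontier D) :
    (gradSq r z / (n * (n + 1)) *
        (∑ k, ∑ l, aUp r z k l *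
          (lapTilde r (dz k (dzbar l (toC r))) z
            - (∑ i, ∑ q, ∑ p, ∑ j,
                aUp r z i q * rInv r z p j * r3 r z i j k * r3bar r z p q l)
            - lapTilde r (dz k (toC r)) z * lapTilde r (dzbar l (toC r)) z
            - n * ((∑ i, rUp r z i * r2 r z i k) * (∑ j, rUpBar r z j * r2bar r z j l))
                / (gradSq r z : ℂ) ^ 2)).re
      - 2 * (∑ k, rUp r z k * lapTilde r (dz k (toC r)) z).re / (n + 1)
      ≤ Etilde r z) ∧
    (Etilde r z ≤
      gradSq r z / (n * (n + 1)) *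
        (∑ k, ∑ l, aUp r z k l *
          (lapTilde r (dz k (dzbar l (toC r))) z
            + (∑ i, ∑ q, ∑ p, ∑ j,
                aUp r z i q * rUp r z p * rUpBar r z j * r3 r z i j k * r3bar r z p q l)
                / (gradSq r z : ℂ)
            + 2 * (∑ i, ∑ q, aUp r z i q * r2 r z i k * r2bar r z q l)
                / (gradSq r z : ℂ))).re
      - 2 * (∑ k, rUp r z k * lapTilde r (dz k (toC r)) z).re / (n + 1)) :=
  proposition4p2_general (isStrictBoundaryPoint_of_mem_frontier hDo hr hpsh hz)
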